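/- **Notation.** Let $\mathbb H$ be the complex Heisenberg group of upper triangular unipotent $3\times 3$ complex matrices with entries $z_1$ (position $(1,2)$), $z_2$ (position $(2,3)$), $z_3$ (position $(1,3)$), let $\Gamma=\mathbb H\cap \mathrm{SL}(3,\mathbb Z[i])$, and let $M=\Gamma\backslash\mathbb H$ be the Iwasawa manifold. Write $x_2=\operatorname{Re} z_2$, and let $\phi^1=dz_1$, $\phi^2=dz_2$, $\phi^3=dz_3-z_1\,dz_2$ be the standard left-invariant $(1,0)$-coframe, $\xi_1=\partial_{z_1}$, $\xi_2=\partial_{z_2}+z_1\partial_{z_3}$, $\xi_3=\partial_{z_3}$ the dual frame. Functions, forms and almost complex structures on $M$ are identified with the $\Gamma$-invariant ones on $\mathbb H$; an almost complex structure on $M$ is *invariant* if its lift to $\mathbb H$ is left-invariant, and *integrable* (a complex structure) if its Nijenhuis tensor vanishes. The canonical bundle is $K_J=\Lambda^{3,0}$; a holomorphic trivialization of it is a smooth nowhere vanishing $(3,0)$-form $\Omega$ on $M$ with $\bar\partial\Omega=0$. With $P_l$ the space of smooth sections $s$ of $K_J^{\otimes l}$ on $M$ with $\bar\partial s=0$,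 the Kodaira dimension is $\kappa_J=-\infty$ if $P_l=0$ for all $l\ge1$, and $\kappa_J=\limsup_{l\to\infty}\log(\dim_{\mathbb C}P_l)/\log l$ otherwise. For a real function $p$ put $$\omega^1=\phi^1,\qquad \omega^2=\phi^2+p\,\phi^{\bar 2},\qquad \omega^3=\phi^3,\qquad \omega^{\bar j}=\overline{\omega^j},$$ and write $\omega^{jk}=\omega^j\wedge\omega^k$, etc. **(a)** Let $p\in C^\infty(M)$ be a non-constant real function depending only on $x_2$, with $|p|\neq1$ everywhere on $M$. Then there is exactly one almost complex structure $J_p$ for which $\omega^1,\omega^2,\omega^3$ is a coframe of $(1,0)$-forms; $J_p$ and the coframe descend to $M$. The structure $J_p$ is integrable and not invariant, the form $(1-p)^{-1}\omega^{123}$ is a holomorphic trivialization of its canonical bundle, and $\kappa_{J_p}=0$. **(b)** Let $A,c\in\mathbb R$ with $|A|<1$, and put $s=\sin(c\,x_2)$, $p=A\,s$ and $B=(1-A^2s^2)^{-1}$ on $\mathbb H$. Then there is exactly one almost complex structure $J$ on $\mathbb H$ for which $\omega^1,\omega^2,\omega^3$ is a coframe of $(1,0)$-forms. The vector fields $$\psi_1=\xi_1,\qquad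 \psi_2=B(\xi_2-A\,s\,\xi_{\bar2}),\qquad \psi_3=\xi_3$$ are of type $(1,0)$ for $J$ and $\omega^j(\psi_k)=\delta_{jk}$; moreover $$d\omega^1=0,\qquad d\omega^2=A\,B\,\partial_{z_2}(s)\,\omega^{2\bar2},\qquad d\omega^3=-B\,(\omega^{12}-A\,s\,\omega^{1\bar2}),$$ $J$ is integrable, $$\bar\partial(\omega^{123})=A\,B\,\partial_{z_2}(s)\,\omega^{123\bar2},$$ which is not identically zero if $A\ne0$ and $c\neq0$, whereas $\bar\partial\big((1-A\,s)^{-1}\omega^{123}\big)=0$. If $c=2\pi k$ with $k\in\mathbb Z$, then $p$ and $J$ descend to $M$, $(1-A\,s)^{-1}\omega^{123}$ is a holomorphic trivialization of the canonical bundle of $J$ on $M$, and $\kappa_J=0$; if in addition $A\neq0$ and $k\ne0$, then $J$ is not invariant. -/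

import Mathlib

open scoped ContDiff TensorProduct

noncomputable section

namespace Iwasawa

/-! ### The complex Heisenberg group, the lattice, and the Iwasawa manifold -/

/-- The coordinates `(z₁, z₂, z₃)`, stored as `z 0, z 1, z 2`. As a real normed space, `Coord`
is also the tangent space of the Heisenberg group at every point (in these coordinates). -/
abbrev Coord : Type := Fin 3 → ℂ

/-- The upper triangular matrix with coordinates `z`. -/
def heisMatrix (z : Coord) : Matrix (Fin 3) (Fin 3) ℂ :=
  !![1, z 0, z 2; 0, 1, z 1; 0, 0, 1]

theorem heisMatrix_mul (a b : Coord) :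
    heisMatrix a * heisMatrix b = heisMatrix ![a 0 + b 0, a 1 + b 1, b 2 + a 0 * b 1 + a 2] := by
  ext i j
  fin_cases i <;> fin_cases j <;> simp [heisMatrix, Matrix.mul_apply, Fin.sum_univ_three] <;> ring

theorem heisMatrix_zero : heisMatrix 0 = 1 := by
  ext i j
  fin_cases i <;> fin_cases j <;> simp [heisMatrix]

theorem det_heisMatrix (z : Coord) : (heisMatrix z).det = 1 := by
  simp [heisMatrix, Matrix.det_fin_three]

/-- The complex Heisenberg group, as a subgroup of `SL(3, ℂ)`. -/
def heisenbergGroup : Subgroup (Matrix.SpecialLinearGroup (Fin 3) ℂ) where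
  carrier := {g | ∃ z : Coord, g.1 = heisMatrix z}
  one_mem' := ⟨0, by simp [heisMatrix_zero]⟩
  mul_mem' := by
    rintro a b ⟨x, hx⟩ ⟨y, hy⟩
    exact ⟨_, by rw [Matrix.SpecialLinearGroup.coe_mul, hx, hy, heisMatrix_mul]⟩
  inv_mem' := by
    rintro a ⟨x, hx⟩
    refine ⟨![-x 0, -x 1, x 0 * x 1 - x 2], ?_⟩
    have h : heisMatrix ![-x 0, -x 1, x 0 * x 1 - x 2] * a.1 = 1 := by
      rw [hx, heisMatrix_mul, ← heisMatrix_zero]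
      congr 1
      ext i
      fin_cases i <;> simp
      ring
    have h2 : (a⁻¹).1 = heisMatrix ![-x 0, -x 1, x 0 * x 1 - x 2] * a.1 * (a⁻¹).1 := by
      rw [h, one_mul]
    rw [h2, mul_assoc, ← Matrix.SpecialLinearGroup.coe_mul, mul_inv_cancel,
      Matrix.SpecialLinearGroup.coe_one, mul_one]

/-- The element of the Heisenberg group with coordinates `z`. -/
def ofCoord (z : Coord) : heisenbergGroup :=
  ⟨⟨heisMatrix z, det_heisMatrix z⟩, z, rfl⟩

/-- The global coordinates on the Heisenberg group. -/
def toCoord (g : heisenbergGroup) : Coord :=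
  ![g.1.1 0 1, g.1.1 1 2, g.1.1 0 2]

theorem toCoord_ofCoord (z : Coord) : toCoord (ofCoord z) = z := by
  ext i
  fin_cases i <;> simp [toCoord, ofCoord, heisMatrix]

theorem ofCoord_toCoord (g : heisenbergGroup) : ofCoord (toCoord g) = g := by
  obtain ⟨g, z, hz⟩ := g
  apply Subtype.ext
  apply Subtype.ext
  have h : toCoord ⟨g, z, hz⟩ = z := by
    ext i
    fin_cases i <;> simp [toCoord, hz, heisMatrix]
  rw [h]
  exact hz.symm

/-- The lattice `Γ = ℍ₃(ℂ) ∩ SL(3, ℤ[i])` in the Heisenberg group. -/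
def lattice : Subgroup heisenbergGroup :=
  (Matrix.SpecialLinearGroup.map (n := Fin 3) GaussianInt.toComplex).range.subgroupOf
    heisenbergGroup

/-- The Iwasawa manifold `Γ \ ℍ₃(ℂ)`: the right cosets `Γ g` of the lattice. -/
def IwasawaManifold : Type := Quotient (QuotientGroup.rightRel lattice)

/-- The covering projection, from the global coordinates on `ℍ₃(ℂ)` to the Iwasawa manifold. -/
def proj (z : Coord) : IwasawaManifold := Quotient.mk (QuotientGroup.rightRel lattice) (ofCoord z)

/-- Left translation `L_h`, in coordinates. -/
def leftTranslation (h : heisenbergGroup) (z : Coord) : Coord := toCoord (h * ofCoord z)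

theorem leftTranslation_apply (h : heisenbergGroup) (z : Coord) :
    leftTranslation h z =
      ![toCoord h 0 + z 0, toCoord h 1 + z 1, z 2 + toCoord h 0 * z 1 + toCoord h 2] := by
  conv_lhs => rw [← ofCoord_toCoord h]
  have : ofCoord (toCoord h) * ofCoord z = ofCoord ![toCoord h 0 + z 0, toCoord h 1 + z 1,
      z 2 + toCoord h 0 * z 1 + toCoord h 2] :=
    Subtype.ext (Subtype.ext (heisMatrix_mul _ _))
  rw [leftTranslation, this, toCoord_ofCoord]

/-! ### Complex-valued differential forms on `ℍ₃(ℂ)`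

Objects on the Iwasawa manifold are `Γ`-invariant objects on `ℍ₃(ℂ)`. -/

/-- Complex-valued alternating `k`-forms on the (real) tangent space. -/
abbrev Form (k : ℕ) : Type := Coord [⋀^Fin k]→L[ℝ] ℂ

/-- Complex-valued covectors. -/
abbrev Covector : Type := Coord →L[ℝ] ℂ

/-- The wedge product `θ₁ ∧ ⋯ ∧ θₙ` of one-forms: `(v₁, …, vₙ) ↦ det (θᵢ(vⱼ))`. -/
def wedge {n : ℕ} (θ : Fin n → Covector) : Form n :=
  { toMultilinearMap :=
      ((Matrix.detRowAlternating (n := Fin n) (R := ℂ)).toMultilinearMap.restrictScalars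
        ℝ).compLinearMap (fun _ => LinearMap.pi fun j => (θ j : Coord →ₗ[ℝ] ℂ))
    map_eq_zero_of_eq' := by
      intro v i j h hij
      refine (Matrix.detRowAlternating (n := Fin n) (R := ℂ)).map_eq_zero_of_eq _ ?_ hij
      simp [h]
    cont := by
      change Continuous fun v : Fin n → Coord => Matrix.det (Matrix.of fun i j => θ j (v i))
      apply Continuous.matrix_det
      fun_prop }

theorem wedge_apply {n : ℕ} (θ : Fin n → Covector) (v : Fin n → Coord) :
    wedge θ v = Matrix.det (Matrix.of fun i j => θ j (v i)) := rfl

/-- Complex conjugate of a covector. -/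
def conjCovector (θ : Covector) : Covector := (Complex.conjCLE : ℂ →L[ℝ] ℂ).comp θ

/-- Pullback of an alternating form by a linear map, as a complex linear map. -/
def pullback {k : ℕ} (T : Coord →L[ℝ] Coord) : Form k →ₗ[ℂ] Form k where
  toFun α := α.compContinuousLinearMap T
  map_add' _ _ := rfl
  map_smul' _ _ := rfl

/-- A differential form on `ℍ₃(ℂ)` is `Γ`-invariant, that is, it is a form on the Iwasawa
manifold. -/
def FormIsLatticeInvariant {k : ℕ} (α : Coord → Form k) : Prop :=
  ∀ γ ∈ lattice, ∀ z,
    pullback (fderiv ℝ (leftTranslation γ) z) (α (leftTranslation γ z)) = α z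

/-! ### Almost complex structures -/

/-- A smooth almost complex structure on `ℍ₃(ℂ)`. -/
structure AlmostComplexStructure where
  J : Coord → Coord →L[ℝ] Coord
  smooth : ContDiff ℝ ∞ J
  sq : ∀ z v, J z (J z v) = -v

/-- The component of bidegree `(p, k - p)`, with respect to the complex structure `J` on `Coord`,
of a complex-valued `k`-form `α`. It is the sum over all sets `S` of `p` arguments of
`α(v'₁, …, v'ₖ)`, where `v'ᵢ` is the `(1,0)`-part `(vᵢ - i J vᵢ)/2` for `i ∈ S` and the
`(0,1)`-part `(vᵢ + i J vᵢ)/2` for `i ∉ S`, and `α` is extended complex multilinearly; the sum over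
`T` is the expansion of this expression. -/
def bidegreePart {k : ℕ} (J : Coord →L[ℝ] Coord) (p : ℕ) (α : Form k) (v : Fin k → Coord) : ℂ :=
  ∑ S ∈ Finset.powersetCard p (Finset.univ : Finset (Fin k)),
    ∑ T ∈ (Finset.univ : Finset (Fin k)).powerset,
      (1 / 2 : ℂ) ^ k * (∏ i ∈ T, if i ∈ S then -Complex.I else Complex.I) *
        α (fun i => if i ∈ T then J (v i) else v i)

theorem bidegreePart_add {k : ℕ} (J : Coord →L[ℝ] Coord) (p : ℕ) (α β : Form k)
    (v : Fin k → Coord) :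
    bidegreePart J p (α + β) v = bidegreePart J p α v + bidegreePart J p β v := by
  simp only [bidegreePart, ContinuousAlternatingMap.add_apply, mul_add, Finset.sum_add_distrib]

theorem bidegreePart_smul {k : ℕ} (J : Coord →L[ℝ] Coord) (p : ℕ) (c : ℂ) (α : Form k)
    (v : Fin k → Coord) : bidegreePart J p (c • α) v = c * bidegreePart J p α v := by
  simp only [bidegreePart, ContinuousAlternatingMap.smul_apply, smul_eq_mul, Finset.mul_sum]
  refine Finset.sum_congr rfl fun S _ => Finset.sum_congr rfl fun T _ => ?_
  ring

theorem extDeriv_const_smul {k : ℕ} (c : ℂ) {α : Coord → Form k} {z : Coord}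
    (h : DifferentiableAt ℝ α z) :
    extDeriv (fun y => c • α y) z = c • extDeriv α z := by
  ext v
  simp only [extDeriv, ContinuousAlternatingMap.smul_apply,
    ContinuousAlternatingMap.alternatizeUncurryFin_apply]
  rw [fderiv_fun_const_smul h, Finset.smul_sum]
  refine Finset.sum_congr rfl fun i _ => ?_
  rw [smul_comm]
  rfl

namespace AlmostComplexStructure

variable (X : AlmostComplexStructure)

/-- `J` commutes with the differential of `L_h`. -/
def IsInvariantUnder (h : heisenbergGroup) : Prop :=
  ∀ z v, X.J (leftTranslation h z) (fderiv ℝ (leftTranslation h) z v) =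
    fderiv ℝ (leftTranslation h) z (X.J z v)

/-- `J` is `Γ`-invariant, that is, it is an almost complex structure on the Iwasawa manifold. -/
def IsLatticeInvariant : Prop := ∀ γ ∈ lattice, X.IsInvariantUnder γ

/-- `J` is left-invariant; on the Iwasawa manifold, `J` is then called an invariant structure. -/
def IsLeftInvariant : Prop := ∀ h, X.IsInvariantUnder h

/-- The Nijenhuis tensor `[JV, JW] - J[JV, W] - J[V, JW] - [V, W]` of two vector fields. -/
def nijenhuis (V W : Coord → Coord) (z : Coord) : Coord :=
  VectorField.lieBracket ℝ (fun y => X.J y (V y)) (fun y => X.J y (W y)) z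
    - X.J z (VectorField.lieBracket ℝ (fun y => X.J y (V y)) W z)
    - X.J z (VectorField.lieBracket ℝ V (fun y => X.J y (W y)) z)
    - VectorField.lieBracket ℝ V W z

/-- `J` is integrable, that is, a complex structure: its Nijenhuis tensor vanishes. -/
def IsIntegrable : Prop :=
  ∀ V W : Coord → Coord, ContDiff ℝ ∞ V → ContDiff ℝ ∞ W → ∀ z, X.nijenhuis V W z = 0

/-- `θ` is a smooth coframe of `(1,0)`-forms of `J`. -/
def IsCoframe (θ : Fin 3 → Coord → Covector) : Prop :=
  (∀ j, ContDiff ℝ ∞ (θ j)) ∧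
  (∀ z, LinearIndependent ℂ (fun j => θ j z)) ∧
  ∀ j z v, θ j z (X.J z v) = Complex.I * θ j z v

/-- The fibre at `z` of the canonical bundle `K_J = Λ^{3,0}`: the alternating three-forms that
are `J`-complex linear in each argument. -/
def canonicalFibre (z : Coord) : Submodule ℂ (Form 3) where
  carrier := {α | ∀ (v : Fin 3 → Coord) (i : Fin 3),
    α (Function.update v i (X.J z (v i))) = Complex.I * α v}
  add_mem' := by
    intro a b ha hb v i
    simp only [ContinuousAlternatingMap.add_apply, ha v i, hb v i]
    ring
  zero_mem' := by simp
  smul_mem' := by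
    intro c a ha v i
    simp only [ContinuousAlternatingMap.smul_apply, ha v i, smul_eq_mul]
    ring

/-- `∂̄` of a `(p, k - p)`-form: the component of bidegree `(p, k - p + 1)` of its differential. -/
def dbar {k : ℕ} (p : ℕ) (α : Coord → Form k) (z : Coord) (v : Fin (k + 1) → Coord) : ℂ :=
  bidegreePart (X.J z) p (extDeriv α z) v

/-- `Ω` is a pseudoholomorphic (for integrable `J`, holomorphic) trivialization of the canonical
bundle of `J` on the Iwasawa manifold: a smooth, `Γ`-invariant, nowhere vanishing `(3,0)`-form
with `∂̄ Ω = 0`. -/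
def IsHolomorphicTrivialization (Ω : Coord → Form 3) : Prop :=
  ContDiff ℝ ∞ Ω ∧ FormIsLatticeInvariant Ω ∧ (∀ z, Ω z ∈ X.canonicalFibre z) ∧
    (∀ z, Ω z ≠ 0) ∧ ∀ z v, X.dbar 3 Ω z v = 0

/-- The `l`-th tensor power of a three-form. -/
def tpow (l : ℕ) (α : Form 3) : ⨂[ℂ]^l (Form 3) := PiTensorProduct.tprod ℂ (fun _ : Fin l => α)

/-- `σ` is a smooth nowhere vanishing section of the canonical bundle over the open set `U`. -/
def IsLocalFrame (U : Set Coord) (σ : Coord → Form 3) : Prop :=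
  IsOpen U ∧ ContDiffOn ℝ ∞ σ U ∧ ∀ z ∈ U, σ z ∈ X.canonicalFibre z ∧ σ z ≠ 0

/-- The space `P_l` of smooth pseudoholomorphic sections of `K_J^{⊗ l}` on the Iwasawa manifold.
Such a section is a `Γ`-invariant section `s` over `ℍ₃(ℂ)` such that, in every local frame `σ`
of `K_J`, one has `s = f σ^{⊗ l}` with `f` smooth and
`∂̄ s = (∂̄(f σ) + (l - 1) f ∂̄ σ) ⊗ σ^{⊗ (l - 1)}` is zero. -/
def pluricanonicalSections (l : ℕ) : Submodule ℂ (Coord → ⨂[ℂ]^l (Form 3)) where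
  carrier := {s |
    (∀ γ ∈ lattice, ∀ z,
      PiTensorProduct.map (fun _ : Fin l => pullback (fderiv ℝ (leftTranslation γ) z))
        (s (leftTranslation γ z)) = s z) ∧
    ∀ (U : Set Coord) (σ : Coord → Form 3), X.IsLocalFrame U σ →
      ∃ f : Coord → ℂ, ContDiffOn ℝ ∞ f U ∧ (∀ z ∈ U, s z = f z • tpow l (σ z)) ∧
        ∀ z ∈ U, ∀ v,
          X.dbar 3 (fun y => f y • σ y) z v + ((l : ℂ) - 1) * f z * X.dbar 3 σ z v = 0}
  add_mem' := by
    rintro s t ⟨hs, hs'⟩ ⟨ht, ht'⟩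
    refine ⟨fun γ hγ z => by simp [hs γ hγ z, ht γ hγ z], fun U σ hσ => ?_⟩
    obtain ⟨f, hf, hsf, hf0⟩ := hs' U σ hσ
    obtain ⟨g, hg, htg, hg0⟩ := ht' U σ hσ
    refine ⟨fun z => f z + g z, hf.add hg, fun z hz => by simp [hsf z hz, htg z hz, add_smul],
      fun z hz v => ?_⟩
    have hU := hσ.1.mem_nhds hz
    have hσd : DifferentiableAt ℝ σ z := (hσ.2.1.contDiffAt hU).differentiableAt (by simp)
    have hfd : DifferentiableAt ℝ f z := (hf.contDiffAt hU).differentiableAt (by simp)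
    have hgd : DifferentiableAt ℝ g z := (hg.contDiffAt hU).differentiableAt (by simp)
    have key : X.dbar 3 (fun y => (f y + g y) • σ y) z v =
        X.dbar 3 (fun y => f y • σ y) z v + X.dbar 3 (fun y => g y • σ y) z v := by
      simp only [dbar]
      have e : extDeriv (fun y => (f y + g y) • σ y) z =
          extDeriv (fun y => f y • σ y) z + extDeriv (fun y => g y • σ y) z := by
        have h : (fun y => (f y + g y) • σ y) = fun y => (f • σ) y + (g • σ) y := by
          funext y
          exact add_smul (f y) (g y) (σ y)
        rw [h]
        exact extDeriv_fun_add (hfd.smul hσd) (hgd.smul hσd)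
      rw [e, bidegreePart_add]
    rw [key]
    linear_combination hf0 z hz v + hg0 z hz v
  zero_mem' := by
    refine ⟨fun γ hγ z => by simp, fun U σ hσ => ⟨fun _ => 0, contDiffOn_const, by simp,
      fun z hz v => ?_⟩⟩
    have h : extDeriv (fun y => (0 : ℂ) • σ y) z = (0 : ℂ) • extDeriv σ z :=
      extDeriv_const_smul 0 ((hσ.2.1.contDiffAt (hσ.1.mem_nhds hz)).differentiableAt (by simp))
    simp only [dbar]
    rw [h, bidegreePart_smul]
    simp
  smul_mem' := by
    rintro c s ⟨hs, hs'⟩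
    refine ⟨fun γ hγ z => by simp [hs γ hγ z], fun U σ hσ => ?_⟩
    obtain ⟨f, hf, hsf, hf0⟩ := hs' U σ hσ
    refine ⟨fun z => c * f z, contDiffOn_const.mul hf,
      fun z hz => by simp [hsf z hz, mul_smul], fun z hz v => ?_⟩
    have hU := hσ.1.mem_nhds hz
    have hσd : DifferentiableAt ℝ σ z := (hσ.2.1.contDiffAt hU).differentiableAt (by simp)
    have hfd : DifferentiableAt ℝ f z := (hf.contDiffAt hU).differentiableAt (by simp)
    have key : X.dbar 3 (fun y => (c * f y) • σ y) z v = c * X.dbar 3 (fun y => f y • σ y) z v := by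
      simp only [dbar, mul_smul]
      have h : extDeriv (fun y => c • f y • σ y) z = c • extDeriv (fun y => f y • σ y) z :=
        extDeriv_const_smul c (hfd.smul hσd)
      rw [h, bidegreePart_smul]
    rw [key]
    linear_combination c * hf0 z hz v

open Classical in
/-- The Kodaira dimension of (a `Γ`-invariant) `J` on the Iwasawa manifold, with values in
`[-∞, ∞]`. -/
def kodairaDimension : EReal :=
  if ∀ l : ℕ, 1 ≤ l → X.pluricanonicalSections l = ⊥ then ⊥
  else Filter.limsup (fun l : ℕ =>
    ENNReal.log ((Cardinal.toENat (Module.rank ℂ (X.pluricanonicalSections l)) : ℕ∞) : ENNReal) /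
      ((Real.log l : ℝ) : EReal)) Filter.atTop

end AlmostComplexStructure

/-! ### The coframes and the complex vector fields -/

/-- The coordinate covector `dz_{j+1}`. -/
def dz (j : Fin 3) : Covector := ContinuousLinearMap.proj j

/-- The left-invariant coframe `φ¹ = dz₁`, `φ² = dz₂`, `φ³ = dz₃ - z₁ dz₂`. -/
def phi (j : Fin 3) (z : Coord) : Covector := ![dz 0, dz 1, dz 2 - z 0 • dz 1] j

/-- The coframe `ω¹ = φ¹`, `ω² = φ² + p φ^{2̄}`, `ω³ = φ³` of a real function `p`. -/
def omega (p : Coord → ℝ) (j : Fin 3) (z : Coord) : Covector :=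
  ![phi 0 z, phi 1 z + (p z : ℂ) • conjCovector (phi 1 z), phi 2 z] j

/-- `ω^{123} = ω¹ ∧ ω² ∧ ω³`. -/
def omega123 (p : Coord → ℝ) (z : Coord) : Form 3 :=
  wedge ![omega p 0 z, omega p 1 z, omega p 2 z]

/-- Complexified tangent vectors. -/
abbrev ComplexVector : Type := ℂ ⊗[ℝ] Coord

/-- The complex linear extension of a covector to complexified tangent vectors. -/
def evalC (θ : Covector) : ComplexVector →ₗ[ℂ] ℂ := LinearMap.liftBaseChange ℂ (θ : Coord →ₗ[ℝ] ℂ)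

/-- Complex conjugation of complexified tangent vectors. -/
def conjVector : ComplexVector →ₗ[ℝ] ComplexVector :=
  LinearMap.rTensor Coord (Complex.conjAe.toLinearMap)

/-- `∂_{z_{j+1}} = (∂_{x_{j+1}} - i ∂_{y_{j+1}}) / 2`. -/
def partialZ (j : Fin 3) : ComplexVector :=
  (1 / 2 : ℂ) • ((1 : ℂ) ⊗ₜ[ℝ] (Pi.single j 1 : Coord) -
    Complex.I ⊗ₜ[ℝ] (Pi.single j Complex.I : Coord))

/-- The frame `ξ₁ = ∂_{z₁}`, `ξ₂ = ∂_{z₂} + z₁ ∂_{z₃}`, `ξ₃ = ∂_{z₃}`. -/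
def xi (j : Fin 3) (z : Coord) : ComplexVector :=
  ![partialZ 0, partialZ 1 + z 0 • partialZ 2, partialZ 2] j

/-- The frame `ψ₁ = ξ₁`, `ψ₂ = (1 - p²)⁻¹ (ξ₂ - p ξ_{2̄})`, `ψ₃ = ξ₃`. -/
def psi (p : Coord → ℝ) (j : Fin 3) (z : Coord) : ComplexVector :=
  ![xi 0 z, (((1 - p z ^ 2)⁻¹ : ℝ) : ℂ) • (xi 1 z - (p z : ℂ) • conjVector (xi 1 z)), xi 2 z] j

/-- The derivative `∂_{z₂} g` of a real function `g`. -/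
def dZ2 (g : Coord → ℝ) (z : Coord) : ℂ :=
  evalC (fderiv ℝ (fun y => (g y : ℂ)) z) (partialZ 1)

end Iwasawa

end

noncomputable section

namespace Iwasawa

/-! ### Wedge products and exterior derivatives -/

/-! Both parts are instances of one situation, `IsProfile`: a smooth real `p` of `x₂` with `|p| ≠
1`. Writing `a + p ā = (1 + p) Re a + i (1 - p) Im a` shows that the `ω^j` determine a tangent
vector, so `J` exists and is unique, with an explicit formula (`jMap`).

Integrability: `dω¹ = 0`, `dω²` is a multiple of `dz₂ ∧ dz̄₂`, hence of `ω^{22̄}`, and `dω³ = -dz₁ ∧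
dz₂` contains the `(1,0)`-form `dz₁`. No differential has a `(0,2)`-part, so every `ω^j` kills the
Nijenhuis tensor (`apply_nijenhuis_eq_zero`).

Canonical bundle: with `Θ = dz₁ ∧ dz₂ ∧ dz̄₂ ∧ dz₃`, one has `dω¹²³ = -(p'/2) Θ` and `dx₂ ∧ ω¹²³ =
((1 - p)/2) Θ`. Thus `d(g ω¹²³) = 0` for a function `g` of `x₂` as soon as `g' (1 - p) = g p'`,
which `g = (1 - p)⁻¹` solves. The resulting form `Ω` is even `d`-closed.

Kodaira dimension: the fibres of `K_J` are complex lines (`eq_smul_omega123`), so a section of the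
`l`-th power is `f Ω^l`, and `∂̄ Ω = 0` turns `∂̄ s = 0` into holomorphy of `f`
(`fderiv_jMap_of_dbar_eq_zero`). Invariance under the cocompact lattice makes `f` bounded. Instead
of a maximum principle, `eq_of_holomorphic` applies Liouville's theorem along entire `J`-holomorphic
curves: the `z₁`- and `z₃`-lines, and a reparametrized `z₂`-line. Hence `f` is constant, every `P_l`
is one-dimensional, and the Kodaira dimension is `0`.

Finally, a left-invariant `J` would force `p` to be constant (`eq_of_isLeftInvariant`). -/

/-- The wedge product `β ∧ α` of a covector and a form. -/
def covectorWedge {k : ℕ} (β : Covector) (α : Form k) : Form (k + 1) :=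
  .alternatizeUncurryFin (β.smulRight α)

theorem covectorWedge_apply {k : ℕ} (β : Covector) (α : Form k) (v : Fin (k + 1) → Coord) :
    covectorWedge β α v = ∑ i, (-1 : ℂ) ^ i.val * (β (v i) * α (i.removeNth v)) := by
  simp only [covectorWedge, ContinuousAlternatingMap.alternatizeUncurryFin_apply]
  refine Finset.sum_congr rfl fun i _ => ?_
  simp [zsmul_eq_mul]

/-- The alternating sum in `covectorWedge_apply` is the Laplace expansion of the determinant along
its first column. -/
theorem covectorWedge_wedge {k : ℕ} (β : Covector) (θ : Fin k → Covector) :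
    covectorWedge β (wedge θ) = wedge (Fin.cons β θ : Fin (k + 1) → Covector) := by
  ext v
  rw [covectorWedge_apply, wedge_apply, Matrix.det_succ_column_zero]
  refine Finset.sum_congr rfl fun i _ => ?_
  rw [wedge_apply, mul_assoc]
  rfl

theorem add_covectorWedge {k : ℕ} (β β' : Covector) (α : Form k) :
    covectorWedge (β + β') α = covectorWedge β α + covectorWedge β' α := by
  ext v
  simp [covectorWedge_apply, mul_add, add_mul, Finset.sum_add_distrib]

theorem covectorWedge_smul {k : ℕ} (β : Covector) (c : ℂ) (α : Form k) :
    covectorWedge β (c • α) = c • covectorWedge β α := by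
  ext v
  simp only [covectorWedge_apply, ContinuousAlternatingMap.smul_apply, smul_eq_mul,
    Finset.mul_sum]
  refine Finset.sum_congr rfl fun i _ => ?_
  ring

theorem smul_covectorWedge {k : ℕ} (β : Covector) (c : ℂ) (α : Form k) :
    covectorWedge (c • β) α = c • covectorWedge β α := by
  ext v
  simp only [covectorWedge_apply, ContinuousAlternatingMap.smul_apply, smul_eq_mul,
    Finset.mul_sum, smul_apply]
  refine Finset.sum_congr rfl fun i _ => ?_
  ring

theorem extDeriv_smul_form {k : ℕ} {f : Coord → ℂ} {α : Coord → Form k} {z : Coord}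
    (hf : DifferentiableAt ℝ f z) (hα : DifferentiableAt ℝ α z) :
    extDeriv (fun y => f y • α y) z = f z • extDeriv α z + covectorWedge (fderiv ℝ f z) (α z) := by
  rw [extDeriv, fderiv_fun_smul hf hα, ContinuousAlternatingMap.alternatizeUncurryFin_add,
    ContinuousAlternatingMap.alternatizeUncurryFin_smul]
  rfl

theorem extDeriv_const_form {k : ℕ} (α : Form k) (z : Coord) :
    extDeriv (fun _ => α) z = 0 := by
  ext v
  simp [extDeriv, ContinuousAlternatingMap.alternatizeUncurryFin_apply]

theorem extDeriv_smul_wedge {k : ℕ} {f : Coord → ℂ} (θ : Fin k → Covector) {z : Coord}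
    (hf : DifferentiableAt ℝ f z) :
    extDeriv (fun y => f y • wedge θ) z =
      wedge (Fin.cons (fderiv ℝ f z) θ : Fin (k + 1) → Covector) := by
  rw [extDeriv_smul_form hf (differentiableAt_const _), extDeriv_const_form, smul_zero, zero_add,
    covectorWedge_wedge]

/-! ### Bidegrees -/

theorem bidegreePart_zero {k : ℕ} (J : Coord →L[ℝ] Coord) (p : ℕ) (v : Fin k → Coord) :
    bidegreePart J p (0 : Form k) v = 0 := by
  simp [bidegreePart]

/-- The wedge product of covectors of type `(1,0)` (those in `P`) and `(0,1)` (the others) has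
pure bidegree. -/
theorem bidegreePart_wedge {k : ℕ} (J : Coord →L[ℝ] Coord) (p : ℕ) (θ : Fin k → Covector)
    (P : Finset (Fin k))
    (hθ : ∀ j v, θ j (J v) = (if j ∈ P then Complex.I else -Complex.I) * θ j v)
    (v : Fin k → Coord) :
    bidegreePart J p (wedge θ) v = if P.card = p then wedge θ v else 0 := by
  classical
  have hdet : ∀ w : Fin k → Coord, wedge θ w =
      ∑ τ : Equiv.Perm (Fin k), ((Equiv.Perm.sign τ : ℤ) : ℂ) * ∏ i, θ (τ i) (w i) := by
    intro w
    rw [wedge_apply, ← Matrix.det_transpose, Matrix.det_apply']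
    rfl
  -- For one permutation, the sum over `T` is an expanded product with one factor `(1 + ε i) / 2`
  -- per argument, where `ε i = 1` if the type demanded by `S` is that of `θ (τ i)` and `ε i = -1`
  -- otherwise. So exactly one `S` survives, the preimage of `P` under `τ`, which has as many
  -- elements as `P`.
  have key : ∀ (S : Finset (Fin k)) (τ : Equiv.Perm (Fin k)),
      ∑ T ∈ (Finset.univ : Finset (Fin k)).powerset,
        (1 / 2 : ℂ) ^ k * (∏ i ∈ T, if i ∈ S then -Complex.I else Complex.I) *
          ∏ i, θ (τ i) (if i ∈ T then J (v i) else v i) =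
      if S = Finset.univ.filter (fun i => τ i ∈ P) then ∏ i, θ (τ i) (v i) else 0 := by
    intro S τ
    have h1 : ∀ T ∈ (Finset.univ : Finset (Fin k)).powerset,
        (1 / 2 : ℂ) ^ k * (∏ i ∈ T, if i ∈ S then -Complex.I else Complex.I) *
          ∏ i, θ (τ i) (if i ∈ T then J (v i) else v i) =
        (∏ i, θ (τ i) (v i)) * ((1 / 2 : ℂ) ^ k * ((∏ i ∈ T,
          ((if i ∈ S then -Complex.I else Complex.I) *
            (if τ i ∈ P then Complex.I else -Complex.I))) * ∏ i ∈ Finset.univ \ T, (1 : ℂ))) := by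
      intro T _
      have h2 : ∏ i, θ (τ i) (if i ∈ T then J (v i) else v i) =
          (∏ i ∈ T, (if τ i ∈ P then Complex.I else -Complex.I)) * ∏ i, θ (τ i) (v i) := by
        have h8 : (∏ i ∈ T, (if τ i ∈ P then Complex.I else -Complex.I)) =
            ∏ i, if i ∈ T then (if τ i ∈ P then Complex.I else -Complex.I) else 1 := by
          simp [Finset.prod_ite_mem]
        rw [h8, ← Finset.prod_mul_distrib]
        refine Finset.prod_congr rfl fun i _ => ?_
        by_cases hi : i ∈ T <;> simp [hi, hθ]
      rw [h2, Finset.prod_mul_distrib]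
      simp only [Finset.prod_const_one]
      ring
    rw [Finset.sum_congr rfl h1, ← Finset.mul_sum, ← Finset.mul_sum, ← Finset.prod_add]
    have h3 : (1 / 2 : ℂ) ^ k * ∏ i : Fin k, ((if i ∈ S then -Complex.I else Complex.I) *
        (if τ i ∈ P then Complex.I else -Complex.I) + 1) =
        ∏ i : Fin k, if (i ∈ S ↔ τ i ∈ P) then 1 else 0 := by
      have h4 : (1 / 2 : ℂ) ^ k = ∏ _i : Fin k, (1 / 2 : ℂ) := by simp
      rw [h4, ← Finset.prod_mul_distrib]
      refine Finset.prod_congr rfl fun i _ => ?_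
      by_cases h5 : i ∈ S <;> by_cases h6 : τ i ∈ P <;> simp [h5, h6] <;> norm_num
    rw [h3]
    by_cases hS : S = Finset.univ.filter (fun i => τ i ∈ P)
    · rw [if_pos hS, Finset.prod_eq_one (s := Finset.univ) (f := fun i => if (i ∈ S ↔ τ i ∈ P)
        then (1 : ℂ) else 0), mul_one]
      intro i _
      rw [if_pos]
      rw [hS]
      simp
    · rw [if_neg hS]
      have : ∃ i, ¬ (i ∈ S ↔ τ i ∈ P) := by
        by_contra! hc
        exact hS (by ext i; simp [hc i])
      obtain ⟨i, hi⟩ := this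
      rw [Finset.prod_eq_zero (f := fun i => if (i ∈ S ↔ τ i ∈ P) then (1 : ℂ) else 0)
        (Finset.mem_univ i) (by rw [if_neg hi]), mul_zero]
  have hcard : ∀ τ : Equiv.Perm (Fin k),
      (Finset.univ.filter (fun i => τ i ∈ P)).card = P.card := by
    intro τ
    refine Finset.card_bij (fun i _ => τ i) (by simp) (by simp) ?_
    intro b hb
    exact ⟨τ.symm b, by simp [hb], by simp⟩
  have h7 : bidegreePart J p (wedge θ) v = ∑ τ : Equiv.Perm (Fin k),
      ((Equiv.Perm.sign τ : ℤ) : ℂ) *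
        ∑ S ∈ Finset.powersetCard p (Finset.univ : Finset (Fin k)),
          if S = Finset.univ.filter (fun i => τ i ∈ P) then ∏ i, θ (τ i) (v i) else 0 := by
    simp only [← key, Finset.mul_sum]
    rw [bidegreePart, Finset.sum_comm (s := Finset.univ (α := Equiv.Perm (Fin k)))]
    refine Finset.sum_congr rfl fun S _ => ?_
    rw [Finset.sum_comm]
    refine Finset.sum_congr rfl fun T _ => ?_
    rw [hdet, Finset.mul_sum]
    refine Finset.sum_congr rfl fun τ _ => ?_
    ring
  rw [h7, hdet v]
  simp only [Finset.sum_ite_eq', Finset.mem_powersetCard, Finset.subset_univ, true_and, hcard]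
  split_ifs with h
  · rfl
  · simp

/-! ### The Nijenhuis tensor on `(1,0)`-forms -/

/-- A `(1,0)`-form whose differential has no `(0,2)`-part annihilates the Nijenhuis tensor. -/
theorem AlmostComplexStructure.apply_nijenhuis_eq_zero (X : AlmostComplexStructure)
    {θ : Coord → Covector} (hθ : ContDiff ℝ ∞ θ)
    (hJ : ∀ z v, θ z (X.J z v) = Complex.I * θ z v) {z : Coord} {d : Coord → Coord → ℂ}
    (hd : ∀ v w, d v w = fderiv ℝ θ z v w - fderiv ℝ θ z w v)
    (h02 : ∀ v w, d v w + Complex.I * d v (X.J z w) + Complex.I * d (X.J z v) w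
      - d (X.J z v) (X.J z w) = 0)
    {V W : Coord → Coord} (hV : ContDiff ℝ ∞ V) (hW : ContDiff ℝ ∞ W) :
    θ z (X.nijenhuis V W z) = 0 := by
  have hθd : DifferentiableAt ℝ θ z := hθ.differentiable (by simp) z
  have hXd : DifferentiableAt ℝ X.J z := X.smooth.differentiable (by simp) z
  -- Differentiating `θ(J U) = i θ(U)` in two ways expresses `θ` of the derivative of `J U` without
  -- any derivative of `J`.
  have main : ∀ U : Coord → Coord, ContDiff ℝ ∞ U → ∀ u,
      θ z (fderiv ℝ (fun y => X.J y (U y)) z u) =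
        Complex.I * (fderiv ℝ θ z u (U z) + θ z (fderiv ℝ U z u))
          - fderiv ℝ θ z u (X.J z (U z)) := by
    intro U hU u
    have hUd : DifferentiableAt ℝ U z := hU.differentiable (by simp) z
    have e1 : fderiv ℝ (fun y => θ y (X.J y (U y))) z u =
        fderiv ℝ θ z u (X.J z (U z)) + θ z (fderiv ℝ (fun y => X.J y (U y)) z u) := by
      rw [fderiv_clm_apply hθd (hXd.clm_apply hUd)]
      simp [add_comm]
    have e2 : fderiv ℝ (fun y => θ y (X.J y (U y))) z u =
        Complex.I * (fderiv ℝ θ z u (U z) + θ z (fderiv ℝ U z u)) := by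
      have : (fun y => θ y (X.J y (U y))) = fun y => Complex.I * θ y (U y) := by
        funext y
        exact hJ y (U y)
      rw [this, fderiv_const_mul (hθd.clm_apply hUd), fderiv_clm_apply hθd hUd]
      simp [add_comm, mul_add]
    linear_combination e2 - e1
  -- The left side of `h` is four times the `(0,2)`-part of `dθ` on `(V, W)`, and it equals `θ` of
  -- the Nijenhuis tensor once `i² = -1` is used.
  have h := h02 (V z) (W z)
  simp only [hd] at h
  simp only [AlmostComplexStructure.nijenhuis, VectorField.lieBracket, map_sub, hJ, main V hV,
    main W hW]
  linear_combination h + (fderiv ℝ θ z (W z) (V z) + θ z (fderiv ℝ V z (W z))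
    - fderiv ℝ θ z (V z) (W z) - θ z (fderiv ℝ W z (V z))) * Complex.I_sq

/-! ### Functions of `x₂` -/

/-- The coordinate `x₂ = Re z₂`. -/
def reCoord : Coord →L[ℝ] ℝ := Complex.reCLM.comp (ContinuousLinearMap.proj 1)

/-- The covector `dx₂`. -/
def dx2 : Covector := Complex.ofRealCLM.comp reCoord

@[simp] theorem dx2_apply (v : Coord) : dx2 v = ((v 1).re : ℂ) := rfl

@[simp] theorem dz_apply (j : Fin 3) (v : Coord) : dz j v = v j := rfl

@[simp] theorem conjCovector_apply (θ : Covector) (v : Coord) :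
    conjCovector θ v = (starRingEnd ℂ) (θ v) := rfl

theorem hasFDerivAt_of_dependsOn_re {f : Coord → ℝ} (hf : Differentiable ℝ f)
    (hx : ∀ z w : Coord, (z 1).re = (w 1).re → f z = f w) (z : Coord) :
    HasFDerivAt f ((fderiv ℝ f z (Pi.single 1 1)) • reCoord) z := by
  have h : HasFDerivAt f (fderiv ℝ f z) z := (hf z).hasFDerivAt
  convert h using 1
  ext v
  -- The vector `v - Re(v₂) ∂_{x₂}` leaves `x₂` unchanged, so `f` is constant along the line it
  -- spans.
  have h0 : fderiv ℝ f z (v - (v 1).re • (Pi.single 1 1 : Coord)) = 0 := by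
    have h1 : HasDerivAt (fun t : ℝ => f (z + t • (v - (v 1).re • (Pi.single 1 1 : Coord))))
        (fderiv ℝ f z (v - (v 1).re • (Pi.single 1 1 : Coord))) 0 := by
      have h2 : HasDerivAt (fun t : ℝ => z + t • (v - (v 1).re • (Pi.single 1 1 : Coord)))
          (v - (v 1).re • (Pi.single 1 1 : Coord)) 0 := by
        simpa using ((hasDerivAt_id (0 : ℝ)).smul_const
          (v - (v 1).re • (Pi.single 1 1 : Coord))).const_add z
      exact (by simpa using h : HasFDerivAt f (fderiv ℝ f z)
        (z + (0 : ℝ) • (v - (v 1).re • (Pi.single 1 1 : Coord)))).comp_hasDerivAt 0 h2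
    have h3 : (fun t : ℝ => f (z + t • (v - (v 1).re • (Pi.single 1 1 : Coord)))) =
        fun _ => f z := by
      funext t
      exact hx _ _ (by simp)
    rw [h3] at h1
    exact h1.unique (hasDerivAt_const _ _)
  rw [map_sub, map_smul, sub_eq_zero] at h0
  rw [h0]
  simp [reCoord, mul_comm]

theorem hasFDerivAt_ofReal_of_dependsOn_re {f : Coord → ℝ} (hf : Differentiable ℝ f)
    (hx : ∀ z w : Coord, (z 1).re = (w 1).re → f z = f w) (z : Coord) :
    HasFDerivAt (fun y => (f y : ℂ)) (((fderiv ℝ f z (Pi.single 1 1) : ℝ) : ℂ) • dx2) z := by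
  have h : HasFDerivAt (fun y => (f y : ℂ))
      (Complex.ofRealCLM.comp ((fderiv ℝ f z (Pi.single 1 1)) • reCoord)) z :=
    Complex.ofRealCLM.hasFDerivAt.comp z (hasFDerivAt_of_dependsOn_re hf hx z)
  have e : Complex.ofRealCLM.comp ((fderiv ℝ f z (Pi.single 1 1)) • reCoord) =
      ((fderiv ℝ f z (Pi.single 1 1) : ℝ) : ℂ) • dx2 := by
    ext v
    simp [reCoord]
  rwa [e] at h

theorem hasFDerivAt_coord_zero (z : Coord) : HasFDerivAt (fun y : Coord => y 0) (dz 0) z :=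
  (dz 0).hasFDerivAt

/-! ### The almost complex structure of `p` -/

/-- A smooth real function of `x₂` that does not take the values `±1`. -/
structure IsProfile (p : Coord → ℝ) : Prop where
  smooth : ContDiff ℝ ∞ p
  dependsOn : ∀ z w : Coord, (z 1).re = (w 1).re → p z = p w
  abs_ne : ∀ z, |p z| ≠ 1

theorem IsProfile.one_sub_ne {p : Coord → ℝ} (h : IsProfile p) (z : Coord) : 1 - p z ≠ 0 := by
  intro h0
  apply h.abs_ne z
  rw [← sub_eq_zero.mp h0, abs_one]

theorem IsProfile.one_add_ne {p : Coord → ℝ} (h : IsProfile p) (z : Coord) : 1 + p z ≠ 0 := by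
  intro h0
  apply h.abs_ne z
  rw [eq_neg_of_add_eq_zero_right h0, abs_neg, abs_one]

theorem IsProfile.one_sub_sq_ne {p : Coord → ℝ} (h : IsProfile p) (z : Coord) :
    1 - p z ^ 2 ≠ 0 := by
  have := mul_ne_zero (h.one_sub_ne z) (h.one_add_ne z)
  intro h0
  apply this
  linear_combination h0

@[simp] theorem omega_zero_apply (p : Coord → ℝ) (z v : Coord) : omega p 0 z v = v 0 := rfl

@[simp] theorem omega_one_apply (p : Coord → ℝ) (z v : Coord) :
    omega p 1 z v = v 1 + p z * (starRingEnd ℂ) (v 1) := rfl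

@[simp] theorem omega_two_apply (p : Coord → ℝ) (z v : Coord) :
    omega p 2 z v = v 2 - z 0 * v 1 := rfl

/-- On the second entry the coframe rescales real and imaginary parts by `1 + p` and `1 - p`, both
nonzero. Identities between tangent vectors (`J² = -1`, uniqueness of `J`, vanishing of the
Nijenhuis tensor, invariance) are all tested through this lemma. -/
theorem IsProfile.omega_injective {p : Coord → ℝ} (h : IsProfile p) {z u v : Coord}
    (huv : ∀ j, omega p j z u = omega p j z v) : u = v := by
  have h0 := huv 0
  have h1 := huv 1
  have h2 := huv 2
  simp only [omega_zero_apply, omega_one_apply, omega_two_apply] at h0 h1 h2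
  have e1 : u 1 = v 1 := by
    have hr := congrArg Complex.re h1
    have hi := congrArg Complex.im h1
    simp at hr hi
    apply Complex.ext
    · apply mul_left_cancel₀ (h.one_add_ne z)
      linear_combination hr
    · apply mul_left_cancel₀ (h.one_sub_ne z)
      linear_combination hi
  funext j
  fin_cases j
  · exact h0
  · exact e1
  · change u 2 = v 2
    rw [e1] at h2
    linear_combination h2

/-- The second component of `J v`, as a function of the second component of `v`. -/
def rotate (t : ℝ) : ℂ →ₗ[ℝ] ℂ where
  toFun a := ⟨-((1 - t) / (1 + t)) * a.im, (1 + t) / (1 - t) * a.re⟩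
  map_add' a b := by
    apply Complex.ext <;> simp <;> ring
  map_smul' r a := by
    apply Complex.ext <;> simp <;> ring

@[simp] theorem rotate_re (t : ℝ) (a : ℂ) : (rotate t a).re = -((1 - t) / (1 + t)) * a.im := rfl

@[simp] theorem rotate_im (t : ℝ) (a : ℂ) : (rotate t a).im = (1 + t) / (1 - t) * a.re := rfl

theorem rotate_eq (t : ℝ) (a : ℂ) : rotate t a =
    ((-((1 - t) / (1 + t)) * a.im : ℝ) : ℂ) + (((1 + t) / (1 - t) * a.re : ℝ) : ℂ) * Complex.I := by
  rw [← rotate_re, ← rotate_im, Complex.re_add_im]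

/-- In the coordinates `((1 + t) Re a, (1 - t) Im a)` the map `rotate t` is the quarter turn; this
is where its two quotients come from. -/
theorem rotate_type {t : ℝ} (h1 : 1 - t ≠ 0) (h2 : 1 + t ≠ 0) (a : ℂ) :
    rotate t a + t * (starRingEnd ℂ) (rotate t a) =
      Complex.I * (a + t * (starRingEnd ℂ) a) := by
  apply Complex.ext
  · simp
    field_simp
    ring
  · simp
    field_simp
    ring

/-- The endomorphism `J` at `z`. -/
def jMap (p : Coord → ℝ) (z : Coord) : Coord →L[ℝ] Coord :=
  LinearMap.toContinuousLinearMap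
    { toFun := fun v => ![Complex.I * v 0, rotate (p z) (v 1),
        Complex.I * (v 2 - z 0 * v 1) + z 0 * rotate (p z) (v 1)]
      map_add' := by
        intro u v
        ext j
        fin_cases j <;> simp <;> ring
      map_smul' := by
        intro r v
        have e : rotate (p z) ((r : ℂ) * v 1) = r * rotate (p z) (v 1) := by
          simpa using (rotate (p z)).map_smul r (v 1)
        ext j
        fin_cases j <;> simp [e] <;> ring }

theorem jMap_apply (p : Coord → ℝ) (z v : Coord) :
    jMap p z v = ![Complex.I * v 0, rotate (p z) (v 1),
        Complex.I * (v 2 - z 0 * v 1) + z 0 * rotate (p z) (v 1)] := rfl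

theorem IsProfile.omega_jMap {p : Coord → ℝ} (h : IsProfile p) (j : Fin 3) (z v : Coord) :
    omega p j z (jMap p z v) = Complex.I * omega p j z v := by
  fin_cases j
  · simp [jMap_apply]
  · simpa [jMap_apply] using rotate_type (h.one_sub_ne z) (h.one_add_ne z) (v 1)
  · simp [jMap_apply]

theorem IsProfile.contDiff_jMap {p : Coord → ℝ} (h : IsProfile p) : ContDiff ℝ ∞ (jMap p) := by
  rw [contDiff_clm_apply_iff]
  intro v
  rw [contDiff_pi]
  have hz : ContDiff ℝ ∞ (fun z : Coord => z 0) := contDiff_apply ℝ ℂ 0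
  have hr : ContDiff ℝ ∞ (fun z => rotate (p z) (v 1)) := by
    simp only [rotate_eq]
    have e1 : ContDiff ℝ ∞ (fun z => (1 - p z) / (1 + p z)) :=
      (contDiff_const.sub h.smooth).div (contDiff_const.add h.smooth) h.one_add_ne
    have e2 : ContDiff ℝ ∞ (fun z => (1 + p z) / (1 - p z)) :=
      (contDiff_const.add h.smooth).div (contDiff_const.sub h.smooth) h.one_sub_ne
    exact (Complex.ofRealCLM.contDiff.comp (e1.neg.mul contDiff_const)).add
      ((Complex.ofRealCLM.contDiff.comp (e2.mul contDiff_const)).mul contDiff_const)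
  intro j
  fin_cases j
  · exact contDiff_const
  · exact hr
  · exact (contDiff_const.mul (contDiff_const.sub (hz.mul contDiff_const))).add (hz.mul hr)

/-- The almost complex structure with `(1,0)`-coframe `ω¹, ω², ω³`. -/
def IsProfile.acs {p : Coord → ℝ} (h : IsProfile p) : AlmostComplexStructure where
  J := jMap p
  smooth := h.contDiff_jMap
  sq z v := h.omega_injective (z := z) fun j => by
    rw [h.omega_jMap, h.omega_jMap, map_neg, ← mul_assoc, Complex.I_mul_I, neg_one_mul]

theorem IsProfile.acs_J {p : Coord → ℝ} (h : IsProfile p) : h.acs.J = jMap p := rfl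

theorem IsProfile.contDiff_omega {p : Coord → ℝ} (h : IsProfile p) (j : Fin 3) :
    ContDiff ℝ ∞ (omega p j) := by
  rw [contDiff_clm_apply_iff]
  intro v
  have hz : ContDiff ℝ ∞ (fun z : Coord => z 0) := contDiff_apply ℝ ℂ 0
  fin_cases j
  · exact contDiff_const
  · have : ContDiff ℝ ∞ (fun z => v 1 + (p z : ℂ) * (starRingEnd ℂ) (v 1)) :=
      contDiff_const.add ((Complex.ofRealCLM.contDiff.comp h.smooth).mul contDiff_const)
    exact this
  · exact contDiff_const.sub (hz.mul contDiff_const)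

theorem IsProfile.isCoframe {p : Coord → ℝ} (h : IsProfile p) : h.acs.IsCoframe (omega p) := by
  refine ⟨h.contDiff_omega, fun z => ?_, fun j z v => h.omega_jMap j z v⟩
  rw [Fintype.linearIndependent_iff]
  intro g hg
  have e : ∀ v : Coord, g 0 * v 0 + g 1 * (v 1 + p z * (starRingEnd ℂ) (v 1)) +
      g 2 * (v 2 - z 0 * v 1) = 0 := by
    intro v
    have := congrArg (fun θ : Covector => θ v) hg
    simpa [Fin.sum_univ_three] using this
  have e0 := e (Pi.single 0 1)
  have e1 := e (Pi.single 1 1)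
  have e2 := e (Pi.single 2 1)
  simp at e0 e1 e2
  rw [e2] at e1
  have hne : (1 + p z : ℂ) ≠ 0 := by exact_mod_cast h.one_add_ne z
  intro j
  fin_cases j
  · exact e0
  · simpa [hne] using e1
  · exact e2

/-- Being of type `(1,0)` prescribes the values of the coframe on `J v`, and these determine `J v`.
-/
theorem IsProfile.isCoframe_iff {p : Coord → ℝ} (h : IsProfile p) (Y : AlmostComplexStructure) :
    Y.IsCoframe (omega p) ↔ Y = h.acs := by
  constructor
  · intro hY
    have : Y.J = h.acs.J := by
      funext z
      ext1 v
      refine h.omega_injective (z := z) fun j => ?_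
      rw [hY.2.2, h.acs_J, h.omega_jMap]
    cases Y
    unfold acs at this ⊢
    congr
  · rintro rfl
    exact h.isCoframe

/-! ### The differentials of the coframe -/

theorem dZ2_eq {f : Coord → ℝ} (hf : Differentiable ℝ f)
    (hx : ∀ z w : Coord, (z 1).re = (w 1).re → f z = f w) (z : Coord) :
    dZ2 f z = (fderiv ℝ f z (Pi.single 1 1) : ℝ) / 2 := by
  rw [dZ2, (hasFDerivAt_ofReal_of_dependsOn_re hf hx z).fderiv]
  simp [evalC, partialZ]
  ring

theorem wedge_omega_zero (p : Coord → ℝ) (z : Coord) :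
    wedge ![omega p 0 z] = wedge ![dz 0] := rfl

/-- This expansion, like the next two, uses wedges with constant covectors, so that the exterior
derivative only falls on scalar coefficients. -/
theorem wedge_omega_one (p : Coord → ℝ) (z : Coord) :
    wedge ![omega p 1 z] = wedge ![dz 1] + (p z : ℂ) • wedge ![conjCovector (dz 1)] := by
  ext v
  simp [wedge_apply]

theorem wedge_omega_two (p : Coord → ℝ) (z : Coord) :
    wedge ![omega p 2 z] = wedge ![dz 2] + (-z 0) • wedge ![dz 1] := by
  ext v
  simp [wedge_apply]
  ring

theorem omega123_eq (p : Coord → ℝ) (z : Coord) :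
    omega123 p z = wedge ![dz 0, dz 1, dz 2] +
      (p z : ℂ) • wedge ![dz 0, conjCovector (dz 1), dz 2] +
      (-(p z * z 0)) • wedge ![dz 0, conjCovector (dz 1), dz 1] := by
  ext v
  simp [omega123, wedge_apply, Matrix.det_fin_three]
  ring

theorem extDeriv_omega_zero (p : Coord → ℝ) (z : Coord) :
    extDeriv (fun y => wedge ![omega p 0 y]) z = 0 := by
  simp only [wedge_omega_zero]
  exact extDeriv_const_form _ _

theorem extDeriv_omega_one {p : Coord → ℝ} (h : IsProfile p) (z : Coord) :
    extDeriv (fun y => wedge ![omega p 1 y]) z =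
      ((fderiv ℝ p z (Pi.single 1 1) : ℝ) : ℂ) • wedge ![dx2, conjCovector (dz 1)] := by
  have hp := hasFDerivAt_ofReal_of_dependsOn_re (h.smooth.differentiable (by simp)) h.dependsOn z
  simp only [wedge_omega_one]
  rw [extDeriv_fun_add (differentiableAt_const _)
    (hp.differentiableAt.smul (differentiableAt_const _)), extDeriv_const_form, zero_add,
    extDeriv_smul_wedge _ hp.differentiableAt, hp.fderiv]
  ext v
  simp [wedge_apply, Matrix.det_fin_two]
  ring

theorem extDeriv_omega_two (p : Coord → ℝ) (z : Coord) :
    extDeriv (fun y => wedge ![omega p 2 y]) z = -wedge ![dz 0, dz 1] := by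
  have h0 : HasFDerivAt (fun y : Coord => -y 0) (-dz 0) z := (hasFDerivAt_coord_zero z).neg
  simp only [wedge_omega_two]
  rw [extDeriv_fun_add (differentiableAt_const _)
    (h0.differentiableAt.smul (differentiableAt_const _)), extDeriv_const_form, zero_add,
    extDeriv_smul_wedge _ h0.differentiableAt, h0.fderiv]
  ext v
  simp [wedge_apply, Matrix.det_fin_two]
  ring

/-- Only the term with coefficient `p` contributes: the differential of `p z₁` is a combination of
`dz₁`, `dz₂`, `dz̄₂`, all of which occur in the form it multiplies. The half comes from `dx₂ = (dz₂
+ dz̄₂) / 2`. -/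
theorem extDeriv_omega123 {p : Coord → ℝ} (h : IsProfile p) (z : Coord) :
    extDeriv (omega123 p) z = -(((fderiv ℝ p z (Pi.single 1 1) / 2 : ℝ) : ℂ) •
      wedge ![dz 0, dz 1, conjCovector (dz 1), dz 2]) := by
  have hp := hasFDerivAt_ofReal_of_dependsOn_re (h.smooth.differentiable (by simp)) h.dependsOn z
  have h0 : HasFDerivAt (fun y : Coord => -((p y : ℂ) * y 0)) _ z :=
    (hp.mul (hasFDerivAt_coord_zero z)).neg
  have e : omega123 p = fun y => (wedge ![dz 0, dz 1, dz 2] +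
      (p y : ℂ) • wedge ![dz 0, conjCovector (dz 1), dz 2]) +
      (-(p y * y 0)) • wedge ![dz 0, conjCovector (dz 1), dz 1] := by
    funext y
    exact omega123_eq p y
  rw [e, extDeriv_fun_add ((differentiableAt_const _).add
      (hp.differentiableAt.smul (differentiableAt_const _)))
      (h0.differentiableAt.smul (differentiableAt_const _)),
    extDeriv_fun_add (differentiableAt_const _)
      (hp.differentiableAt.smul (differentiableAt_const _)), extDeriv_const_form, zero_add,
    extDeriv_smul_wedge _ hp.differentiableAt, hp.fderiv,
    extDeriv_smul_wedge _ h0.differentiableAt, h0.fderiv]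
  ext v
  simp [wedge_apply, Matrix.det_succ_row_zero, Fin.sum_univ_succ, Fin.succAbove,
    Complex.re_eq_add_conj]
  ring

/-! ### Integrability -/

theorem IsProfile.fderiv_omega_apply {p : Coord → ℝ} (h : IsProfile p) (j : Fin 3) (z v w : Coord) :
    fderiv ℝ (omega p j) z v w = fderiv ℝ (fun y => omega p j y w) z v := by
  rw [fderiv_clm_apply ((h.contDiff_omega j).differentiable (by simp) z)
    (differentiableAt_const w)]
  simp

theorem IsProfile.fderiv_omega_one {p : Coord → ℝ} (h : IsProfile p) (z v w : Coord) :
    fderiv ℝ (omega p 1) z v w =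
      (fderiv ℝ p z (Pi.single 1 1) : ℝ) * (v 1).re * (starRingEnd ℂ) (w 1) := by
  have hp := hasFDerivAt_ofReal_of_dependsOn_re (h.smooth.differentiable (by simp)) h.dependsOn z
  have := (hp.mul_const' ((starRingEnd ℂ) (w 1))).const_add (w 1)
  rw [h.fderiv_omega_apply]
  simp only [omega_one_apply]
  rw [this.fderiv]
  simp
  ring

theorem IsProfile.fderiv_omega_two {p : Coord → ℝ} (h : IsProfile p) (z v w : Coord) :
    fderiv ℝ (omega p 2) z v w = -(v 0 * w 1) := by
  have := ((hasFDerivAt_coord_zero z).mul_const' (w 1)).const_sub (w 2)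
  rw [h.fderiv_omega_apply]
  simp only [omega_two_apply]
  rw [this.fderiv]
  simp [mul_comm]

/-- Splits `dz₂` into its `(1,0)`- and `(0,1)`-parts, on which `J` acts by `i` and `-i`; type
identities then become polynomial ones. -/
theorem IsProfile.dz_one_eq {p : Coord → ℝ} (h : IsProfile p) (z v : Coord) :
    v 1 = (1 - (p z : ℂ) ^ 2)⁻¹ * (omega p 1 z v - p z * (starRingEnd ℂ) (omega p 1 z v)) := by
  have hne : (1 - (p z : ℂ) ^ 2) ≠ 0 := by exact_mod_cast h.one_sub_sq_ne z
  rw [inv_mul_eq_div, eq_div_iff hne]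
  simp
  ring

/-- For each `j` the `(0,2)`-part of `dω^j` vanishes: for `j = 1` by closedness, for `j = 2` because
the differential is proportional to `ω^{22̄}`, for `j = 3` because of the factor `dz₁`. -/
theorem IsProfile.isIntegrable {p : Coord → ℝ} (h : IsProfile p) : h.acs.IsIntegrable := by
  intro V W hV hW z
  refine h.omega_injective (z := z) fun j => ?_
  rw [map_zero]
  refine h.acs.apply_nijenhuis_eq_zero (h.contDiff_omega j) (fun z v => h.omega_jMap j z v)
    (fun v w => rfl) ?_ hV hW
  intro v w
  rw [h.acs_J]
  fin_cases j
  · simp [h.fderiv_omega_apply]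
  · simp only [Fin.mk_one, h.fderiv_omega_one, Complex.re_eq_add_conj]
    rw [h.dz_one_eq z v, h.dz_one_eq z w, h.dz_one_eq z (jMap p z v), h.dz_one_eq z (jMap p z w)]
    simp only [map_mul, map_sub, map_inv₀, map_pow, map_one, Complex.conj_ofReal,
      Complex.conj_conj, Complex.conj_I, map_neg, h.omega_jMap]
    generalize omega p 1 z v = a
    generalize omega p 1 z w = b
    ring_nf
    simp only [Complex.I_sq]
    ring
  · have e0 : ∀ u, jMap p z u 0 = Complex.I * u 0 := fun u => rfl
    simp only [Fin.reduceFinMk, h.fderiv_omega_two, e0]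
    rw [h.dz_one_eq z v, h.dz_one_eq z w, h.dz_one_eq z (jMap p z v), h.dz_one_eq z (jMap p z w)]
    simp only [h.omega_jMap, map_mul, Complex.conj_I]
    generalize omega p 1 z v = a
    generalize omega p 1 z w = b
    ring_nf
    simp only [Complex.I_sq]
    ring

/-! ### `∂̄` of `ω¹²³` and of its closed multiple -/

theorem IsProfile.conj_omega_jMap {p : Coord → ℝ} (h : IsProfile p) (j : Fin 3) (z v : Coord) :
    conjCovector (omega p j z) (jMap p z v) = -Complex.I * conjCovector (omega p j z) v := by
  rw [conjCovector_apply, h.omega_jMap, map_mul, Complex.conj_I, conjCovector_apply]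

theorem wedge_omega_conj (p : Coord → ℝ) (z : Coord) :
    wedge ![omega p 0 z, omega p 1 z, omega p 2 z, conjCovector (omega p 1 z)] =
      -((1 - (p z : ℂ) ^ 2) • wedge ![dz 0, dz 1, conjCovector (dz 1), dz 2]) := by
  ext v
  simp [wedge_apply, Matrix.det_succ_row_zero, Fin.sum_univ_succ, Fin.succAbove]
  ring

/-- The differential is a multiple of `ω^{1232̄}`, already of type `(3,1)`, so the projection in
`∂̄` changes nothing. The set `{0, 1, 2}` marks the positions of the `(1,0)`-factors. -/
theorem IsProfile.dbar_omega123 {p : Coord → ℝ} (h : IsProfile p) (z : Coord)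
    (v : Fin 4 → Coord) :
    h.acs.dbar 3 (omega123 p) z v =
      ((fderiv ℝ p z (Pi.single 1 1) / 2 : ℝ) : ℂ) * (1 - (p z : ℂ) ^ 2)⁻¹ *
        wedge ![omega p 0 z, omega p 1 z, omega p 2 z, conjCovector (omega p 1 z)] v := by
  have hne : (1 - (p z : ℂ) ^ 2) ≠ 0 := by exact_mod_cast h.one_sub_sq_ne z
  have e : extDeriv (omega123 p) z =
      (((fderiv ℝ p z (Pi.single 1 1) / 2 : ℝ) : ℂ) * (1 - (p z : ℂ) ^ 2)⁻¹) •
        wedge ![omega p 0 z, omega p 1 z, omega p 2 z, conjCovector (omega p 1 z)] := by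
    rw [extDeriv_omega123 h, wedge_omega_conj, smul_neg, smul_smul, mul_assoc,
      inv_mul_cancel₀ hne, mul_one]
  rw [AlmostComplexStructure.dbar, e, bidegreePart_smul, bidegreePart_wedge _ _ _ {0, 1, 2}]
  · rw [if_pos (by decide)]
  · intro j u
    rw [h.acs_J]
    fin_cases j
    · simpa using h.omega_jMap 0 z u
    · simpa using h.omega_jMap 1 z u
    · simpa using h.omega_jMap 2 z u
    · simpa using h.conj_omega_jMap 1 z u

/-- The form `(1 - p)⁻¹ ω¹²³`. -/
def trivialization (p : Coord → ℝ) (z : Coord) : Form 3 :=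
  (((1 - p z)⁻¹ : ℝ) : ℂ) • omega123 p z

theorem IsProfile.contDiff_inv {p : Coord → ℝ} (h : IsProfile p) :
    ContDiff ℝ ∞ (fun z => (1 - p z)⁻¹) :=
  (contDiff_const.sub h.smooth).inv h.one_sub_ne

theorem IsProfile.contDiff_omega123 {p : Coord → ℝ} (h : IsProfile p) :
    ContDiff ℝ ∞ (omega123 p) := by
  have e : omega123 p = fun y => (wedge ![dz 0, dz 1, dz 2] +
      (p y : ℂ) • wedge ![dz 0, conjCovector (dz 1), dz 2]) +
      (-(p y * y 0)) • wedge ![dz 0, conjCovector (dz 1), dz 1] := by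
    funext y
    exact omega123_eq p y
  have hz : ContDiff ℝ ∞ (fun z : Coord => z 0) := contDiff_apply ℝ ℂ 0
  have hp : ContDiff ℝ ∞ (fun z => (p z : ℂ)) := Complex.ofRealCLM.contDiff.comp h.smooth
  rw [e]
  exact (contDiff_const.add (hp.smul contDiff_const)).add ((hp.mul hz).neg.smul contDiff_const)

theorem IsProfile.contDiff_trivialization {p : Coord → ℝ} (h : IsProfile p) :
    ContDiff ℝ ∞ (trivialization p) :=
  (Complex.ofRealCLM.contDiff.comp h.contDiff_inv).smul h.contDiff_omega123

/-- The derivative `p' (1 - p)⁻²` of the factor meets `dx₂ ∧ ω¹²³`, which carries `(1 - p) / 2`; the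
product cancels `(1 - p)⁻¹ dω¹²³`. -/
theorem IsProfile.extDeriv_trivialization {p : Coord → ℝ} (h : IsProfile p) (z : Coord) :
    extDeriv (trivialization p) z = 0 := by
  have hne : (1 - (p z : ℂ)) ≠ 0 := by exact_mod_cast h.one_sub_ne z
  have hp := hasFDerivAt_of_dependsOn_re (h.smooth.differentiable (by simp)) h.dependsOn z
  have hi := hasFDerivAt_ofReal_of_dependsOn_re (h.contDiff_inv.differentiable (by simp))
    (fun y w hyw => by rw [h.dependsOn y w hyw]) z
  have hi' : fderiv ℝ (fun y => (1 - p y)⁻¹) z (Pi.single 1 1) =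
      ((1 - p z) ^ 2)⁻¹ * fderiv ℝ p z (Pi.single 1 1) := by
    have h1 : HasFDerivAt (fun y => (1 - p y)⁻¹) _ z :=
      (hasDerivAt_inv (h.one_sub_ne z)).comp_hasFDerivAt z (hp.const_sub 1)
    rw [h1.fderiv]
    simp [reCoord]
  rw [hi'] at hi
  have e0 : trivialization p = fun y => (((1 - p y)⁻¹ : ℝ) : ℂ) • omega123 p y := rfl
  rw [e0, extDeriv_smul_form hi.differentiableAt (h.contDiff_omega123.differentiable (by simp) z),
    extDeriv_omega123 h, hi.fderiv, omega123, smul_covectorWedge, covectorWedge_wedge]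
  have e : wedge (Fin.cons dx2 ![omega p 0 z, omega p 1 z, omega p 2 z] : Fin 4 → Covector) =
      ((1 - (p z : ℂ)) / 2) • wedge ![dz 0, dz 1, conjCovector (dz 1), dz 2] := by
    ext v
    simp [wedge_apply, Matrix.det_succ_row_zero, Fin.sum_univ_succ, Fin.succAbove,
      Complex.re_eq_add_conj]
    ring
  rw [e]
  ext v
  simp
  field_simp
  ring

theorem IsProfile.dbar_trivialization {p : Coord → ℝ} (h : IsProfile p) (z : Coord)
    (v : Fin 4 → Coord) : h.acs.dbar 3 (trivialization p) z v = 0 := by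
  rw [AlmostComplexStructure.dbar, h.extDeriv_trivialization, bidegreePart_zero]

/-! ### Invariance -/

theorem hasFDerivAt_leftTranslation (g : heisenbergGroup) (z : Coord) :
    HasFDerivAt (leftTranslation g)
      (ContinuousLinearMap.pi ![dz 0, dz 1, dz 2 + toCoord g 0 • dz 1]) z := by
  rw [hasFDerivAt_pi']
  have e : leftTranslation g = fun z => ![toCoord g 0 + z 0, toCoord g 1 + z 1,
      z 2 + toCoord g 0 * z 1 + toCoord g 2] := funext (leftTranslation_apply g)
  rw [e]
  intro j
  fin_cases j
  · exact ((dz 0).hasFDerivAt (x := z)).const_add _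
  · exact ((dz 1).hasFDerivAt (x := z)).const_add _
  · exact (((dz 2).hasFDerivAt (x := z)).add
      (((dz 1).hasFDerivAt (x := z)).const_mul (toCoord g 0))).add_const _

theorem fderiv_leftTranslation_apply (g : heisenbergGroup) (z v : Coord) :
    fderiv ℝ (leftTranslation g) z v = ![v 0, v 1, v 2 + toCoord g 0 * v 1] := by
  rw [(hasFDerivAt_leftTranslation g z).fderiv]
  ext j
  fin_cases j <;> rfl

/-- The `φ^j` are left-invariant, so only the coefficient `p` could change under translation. -/
theorem omega_leftTranslation {p : Coord → ℝ} {g : heisenbergGroup} {z : Coord}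
    (hg : p (leftTranslation g z) = p z) (j : Fin 3) (v : Coord) :
    omega p j (leftTranslation g z) (fderiv ℝ (leftTranslation g) z v) = omega p j z v := by
  rw [fderiv_leftTranslation_apply]
  fin_cases j
  · simp
  · simp [hg]
  · simp [leftTranslation_apply]
    ring

theorem pullback_wedge_omega {p : Coord → ℝ} {g : heisenbergGroup} {z : Coord}
    (hg : p (leftTranslation g z) = p z) {k : ℕ} (σ : Fin k → Fin 3) :
    pullback (fderiv ℝ (leftTranslation g) z)
      (wedge fun i => omega p (σ i) (leftTranslation g z)) = wedge fun i => omega p (σ i) z := by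
  ext v
  change wedge _ (fun i => fderiv ℝ (leftTranslation g) z (v i)) = _
  simp only [wedge_apply, omega_leftTranslation hg]

theorem omega123_eq_wedge (p : Coord → ℝ) (z : Coord) :
    omega123 p z = wedge fun i => omega p i z := by
  rw [omega123]
  congr 1

theorem pullback_trivialization {p : Coord → ℝ} {g : heisenbergGroup} {z : Coord}
    (hg : p (leftTranslation g z) = p z) :
    pullback (fderiv ℝ (leftTranslation g) z) (trivialization p (leftTranslation g z)) =
      trivialization p z := by
  rw [trivialization, trivialization, map_smul, hg, omega123_eq_wedge, omega123_eq_wedge,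
    pullback_wedge_omega hg fun i => i]

theorem formIsLatticeInvariant_omega {p : Coord → ℝ}
    (hinv : ∀ γ ∈ lattice, ∀ z, p (leftTranslation γ z) = p z) (j : Fin 3) :
    FormIsLatticeInvariant (fun z => wedge ![omega p j z]) := by
  intro γ hγ z
  have e : ∀ y, wedge ![omega p j y] = wedge fun _ : Fin 1 => omega p j y := by
    intro y
    congr 1
    funext i
    fin_cases i
    rfl
  simp only [e]
  exact pullback_wedge_omega (hinv γ hγ z) fun _ : Fin 1 => j

theorem IsProfile.isLatticeInvariant {p : Coord → ℝ} (h : IsProfile p)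
    (hinv : ∀ γ ∈ lattice, ∀ z, p (leftTranslation γ z) = p z) : h.acs.IsLatticeInvariant := by
  intro γ hγ z v
  refine h.omega_injective (z := leftTranslation γ z) fun j => ?_
  rw [h.acs_J, h.omega_jMap, omega_leftTranslation (hinv γ hγ z),
    omega_leftTranslation (hinv γ hγ z), h.omega_jMap]

/-- Translation by `(0, w₂ - z₂, 0)` has identity differential and carries `z` to a point with the
`x₂` of `w`. Invariance then equates the entry `(1 + p) / (1 - p)` of `J` at the two points, and
this is an injective function of `p`. -/
theorem IsProfile.eq_of_isLeftInvariant {p : Coord → ℝ} (h : IsProfile p)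
    (hX : h.acs.IsLeftInvariant) (z w : Coord) : p z = p w := by
  have h1 := hX (ofCoord ![0, w 1 - z 1, 0]) z (Pi.single 1 1)
  have h2 := congrArg (fun u : Coord => (u 1).im) h1
  have hpw : p (leftTranslation (ofCoord ![0, w 1 - z 1, 0]) z) = p w := by
    apply h.dependsOn
    rw [leftTranslation_apply, toCoord_ofCoord]
    simp
  simp [h.acs_J, jMap_apply, fderiv_leftTranslation_apply, hpw] at h2
  have a := h.one_sub_ne z
  have b := h.one_sub_ne w
  field_simp at h2
  linarith

/-! ### The canonical bundle -/

theorem IsProfile.omega123_mem {p : Coord → ℝ} (h : IsProfile p) (z : Coord) :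
    omega123 p z ∈ h.acs.canonicalFibre z := by
  intro v i
  rw [omega123_eq_wedge, wedge_apply, wedge_apply]
  have e : (Matrix.of fun k j => omega p j z (Function.update v i (h.acs.J z (v i)) k)) =
      (Matrix.of fun k j => omega p j z (v k)).updateRow i
        (Complex.I • (Matrix.of fun k j => omega p j z (v k)) i) := by
    ext k j
    by_cases hk : k = i
    · subst hk
      simp [h.acs_J, h.omega_jMap]
    · simp [hk]
  rw [e, Matrix.det_updateRow_smul, Matrix.updateRow_eq_self]

/-- The vector on which `ω¹, ω², ω³` take the values `w`. -/
def coframeInv (p : Coord → ℝ) (z w : Coord) : Coord :=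
  ![w 0, ⟨(w 1).re / (1 + p z), (w 1).im / (1 - p z)⟩,
    w 2 + z 0 * ⟨(w 1).re / (1 + p z), (w 1).im / (1 - p z)⟩]

theorem IsProfile.omega_coframeInv {p : Coord → ℝ} (h : IsProfile p) (z w : Coord) (j : Fin 3) :
    omega p j z (coframeInv p z w) = w j := by
  have h1 := h.one_sub_ne z
  have h2 := h.one_add_ne z
  fin_cases j
  · simp [coframeInv]
  · apply Complex.ext
    · simp [coframeInv]
      field_simp
    · simp [coframeInv]
      field_simp
      ring
  · simp [coframeInv]

/-- The standard complex frame of `ℂ³`. -/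
def stdFrame : Fin 3 → Coord := fun j => Pi.single j 1

theorem omega123_stdFrame (p : Coord → ℝ) (z : Coord) : omega123 p z stdFrame = 1 + p z := by
  rw [omega123, wedge_apply, Matrix.det_fin_three]
  simp [stdFrame]

/-- Transported by the inverse coframe `coframeInv`, `J` becomes multiplication by `i` and `α` a
complex trilinear alternating form on `ℂ³`, hence a multiple of the determinant, to which `ω¹²³`
corresponds. -/
theorem IsProfile.eq_smul_omega123 {p : Coord → ℝ} (h : IsProfile p) {z : Coord} {α : Form 3}
    (hα : α ∈ h.acs.canonicalFibre z) : α = (α stdFrame / (1 + p z)) • omega123 p z := by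
  have hne : (1 + (p z : ℂ)) ≠ 0 := by exact_mod_cast h.one_add_ne z
  have hadd : ∀ u w, coframeInv p z (u + w) = coframeInv p z u + coframeInv p z w := by
    intro u w
    refine h.omega_injective (z := z) fun j => ?_
    rw [map_add, h.omega_coframeInv, h.omega_coframeInv, h.omega_coframeInv]
    rfl
  -- The scalar `c` acts on tangent vectors as `Re c + (Im c) J`.
  have hsmul : ∀ (c : ℂ) w, coframeInv p z (c • w) =
      c.re • coframeInv p z w + c.im • jMap p z (coframeInv p z w) := by
    intro c w
    refine h.omega_injective (z := z) fun j => ?_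
    rw [map_add, map_smul, map_smul, h.omega_jMap, h.omega_coframeInv, h.omega_coframeInv]
    simp
    linear_combination -(w j) * Complex.re_add_im c
  have hupd : ∀ (w : Fin 3 → Coord) (i : Fin 3) (x : Coord),
      (fun k => coframeInv p z (Function.update w i x k)) =
        Function.update (fun k => coframeInv p z (w k)) i (coframeInv p z x) := by
    intro w i x
    funext k
    exact Function.apply_update (fun _ => coframeInv p z) w i x k
  let f : Coord [⋀^Fin 3]→ₗ[ℂ] ℂ :=
    { MultilinearMap.mk' (fun w : Fin 3 → Coord => α (fun k => coframeInv p z (w k)))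
        (fun w i x y => by
          rw [hupd, hupd, hupd, hadd, α.map_update_add])
        (fun w i c x => by
          have := hα (Function.update (fun k => coframeInv p z (w k)) i (coframeInv p z x)) i
          rw [Function.update_idem, Function.update_self, h.acs_J] at this
          rw [hupd, hupd, hsmul, α.map_update_add, α.map_update_smul, α.map_update_smul, this]
          simp
          linear_combination α (Function.update (fun k => coframeInv p z (w k)) i
            (coframeInv p z x)) * Complex.re_add_im c) with
      map_eq_zero_of_eq' := by
        intro w i j hw hij
        exact α.map_eq_zero_of_eq _ (by rw [hw]) hij }
  have hf : ∀ v, α v = f (Pi.basisFun ℂ (Fin 3)) * omega123 p z v := by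
    intro v
    have e1 : α v = f (fun k j => omega p j z (v k)) := by
      change α v = α (fun k => coframeInv p z (fun j => omega p j z (v k)))
      congr 1
      funext k
      exact h.omega_injective fun j => by rw [h.omega_coframeInv]
    have e2 := congrArg (fun g : Coord [⋀^Fin 3]→ₗ[ℂ] ℂ => g (fun k j => omega p j z (v k)))
      (f.eq_smul_basis_det (Pi.basisFun ℂ (Fin 3)))
    simp only [AlternatingMap.smul_apply, Pi.basisFun_det_apply] at e2
    rw [e1, e2, omega123_eq_wedge, wedge_apply]
    rfl
  have hs := hf stdFrame
  rw [omega123_stdFrame] at hs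
  ext v
  rw [ContinuousAlternatingMap.smul_apply, hs, mul_div_cancel_right₀ _ hne, hf v, smul_eq_mul]

theorem IsProfile.trivialization_mem {p : Coord → ℝ} (h : IsProfile p) (z : Coord) :
    trivialization p z ∈ h.acs.canonicalFibre z :=
  Submodule.smul_mem _ _ (h.omega123_mem z)

theorem trivialization_stdFrame (p : Coord → ℝ) (z : Coord) :
    trivialization p z stdFrame = (((1 - p z)⁻¹ : ℝ) : ℂ) * (1 + p z) := by
  rw [trivialization, ContinuousAlternatingMap.smul_apply, omega123_stdFrame, smul_eq_mul]

theorem IsProfile.trivialization_stdFrame_ne {p : Coord → ℝ} (h : IsProfile p) (z : Coord) :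
    trivialization p z stdFrame ≠ 0 := by
  rw [trivialization_stdFrame]
  exact mul_ne_zero (by exact_mod_cast inv_ne_zero (h.one_sub_ne z))
    (by exact_mod_cast h.one_add_ne z)

theorem IsProfile.trivialization_ne {p : Coord → ℝ} (h : IsProfile p) (z : Coord) :
    trivialization p z ≠ 0 := fun h0 => h.trivialization_stdFrame_ne z (by rw [h0]; rfl)

theorem IsProfile.isHolomorphicTrivialization {p : Coord → ℝ} (h : IsProfile p)
    (hinv : ∀ γ ∈ lattice, ∀ z, p (leftTranslation γ z) = p z) :
    h.acs.IsHolomorphicTrivialization (trivialization p) :=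
  ⟨h.contDiff_trivialization, fun γ hγ z => pullback_trivialization (hinv γ hγ z),
    h.trivialization_mem, h.trivialization_ne, h.dbar_trivialization⟩

theorem IsProfile.eq_smul_trivialization {p : Coord → ℝ} (h : IsProfile p) {z : Coord} {α : Form 3}
    (hα : α ∈ h.acs.canonicalFibre z) :
    α = (α stdFrame / trivialization p z stdFrame) • trivialization p z := by
  have h1 : (1 + (p z : ℂ)) ≠ 0 := by exact_mod_cast h.one_add_ne z
  have h2 : (1 - (p z : ℂ)) ≠ 0 := by exact_mod_cast h.one_sub_ne z
  conv_lhs => rw [h.eq_smul_omega123 hα]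
  rw [trivialization_stdFrame, trivialization, smul_smul]
  congr 1
  push_cast
  field_simp

/-! ### Holomorphic functions -/

/-- If `f Ω` is `∂̄`-closed, then `f` is holomorphic. -/
theorem IsProfile.fderiv_jMap_of_dbar_eq_zero {p : Coord → ℝ} (h : IsProfile p) {f : Coord → ℂ}
    {z : Coord} (hf : DifferentiableAt ℝ f z)
    (h0 : ∀ v, h.acs.dbar 3 (fun y => f y • trivialization p y) z v = 0) (v : Coord) :
    fderiv ℝ f z (jMap p z v) = Complex.I * fderiv ℝ f z v := by
  have hJJ : ∀ u, jMap p z (jMap p z u) = -u := h.acs.sq z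
  -- `a` and `b` are the `(1,0)`- and `(0,1)`-parts of `df`. Since `Ω` is closed, `∂̄(f Ω)` is `b ∧
  -- Ω`; the part `a ∧ Ω` has type `(4,0)` and is discarded.
  let a : Covector := (1 / 2 : ℂ) • (fderiv ℝ f z - Complex.I • (fderiv ℝ f z).comp (jMap p z))
  let b : Covector := (1 / 2 : ℂ) • (fderiv ℝ f z + Complex.I • (fderiv ℝ f z).comp (jMap p z))
  have hb_apply : ∀ u, b u = 1 / 2 * (fderiv ℝ f z u + Complex.I * fderiv ℝ f z (jMap p z u)) :=
    fun u => rfl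
  have ha : ∀ u, a (jMap p z u) = Complex.I * a u := by
    intro u
    simp [a, hJJ]
    ring_nf
    simp only [Complex.I_sq]
    ring
  have hb : ∀ u, b (jMap p z u) = -Complex.I * b u := by
    intro u
    simp [b, hJJ]
    ring_nf
    simp only [Complex.I_sq]
    ring
  have hab : fderiv ℝ f z = a + b := by
    ext u
    simp [a, b]
    ring
  have hh : (((1 - p z)⁻¹ : ℝ) : ℂ) ≠ 0 := by exact_mod_cast inv_ne_zero (h.one_sub_ne z)
  have key : ∀ w, wedge (Fin.cons b (fun i => omega p i z) : Fin 4 → Covector) w = 0 := by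
    intro w
    have h1 := h0 w
    rw [AlmostComplexStructure.dbar, extDeriv_smul_form hf
      (h.contDiff_trivialization.differentiable (by simp) z), h.extDeriv_trivialization, smul_zero,
      zero_add, trivialization, covectorWedge_smul, bidegreePart_smul, hab, add_covectorWedge,
      bidegreePart_add, omega123_eq_wedge, covectorWedge_wedge, covectorWedge_wedge,
      bidegreePart_wedge _ _ _ Finset.univ, bidegreePart_wedge _ _ _ {1, 2, 3},
      if_neg (by decide), if_pos (by decide), zero_add] at h1
    · exact (mul_eq_zero.mp h1).resolve_left hh
    · intro j u
      rw [h.acs_J]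
      refine Fin.cases ?_ (fun i => ?_) j
      · simpa using hb u
      · have hi : i.succ ∈ ({1, 2, 3} : Finset (Fin 4)) := by fin_cases i <;> decide
        simpa [hi] using h.omega_jMap i z u
    · intro j u
      rw [h.acs_J]
      refine Fin.cases ?_ (fun i => ?_) j
      · simpa using ha u
      · simpa using h.omega_jMap i z u
  -- The first argument is in effect `v + i J v`, twice the `(0,1)`-part of `v`. The `ω^j` vanish on
  -- it, so the expansion along the first row keeps only the entry `2 b(v)`.
  have e : wedge (Fin.cons b (fun i => omega p i z) : Fin 4 → Covector)
        (Fin.cons v stdFrame : Fin 4 → Coord) +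
      Complex.I * wedge (Fin.cons b (fun i => omega p i z) : Fin 4 → Covector)
        (Fin.cons (jMap p z v) stdFrame : Fin 4 → Coord) = 2 * b v * omega123 p z stdFrame := by
    have hj : ∀ j : Fin 4, (Fin.cons b (fun i => omega p i z) : Fin 4 → Covector) j v +
        Complex.I * (Fin.cons b (fun i => omega p i z) : Fin 4 → Covector) j (jMap p z v) =
          if j = 0 then 2 * b v else 0 := by
      intro j
      refine Fin.cases ?_ (fun i => ?_) j
      · simp only [Fin.cons_zero, hb, if_true]
        linear_combination (-b v) * Complex.I_sq
      · simp only [Fin.cons_succ, h.omega_jMap, Fin.succ_ne_zero, if_false]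
        linear_combination omega p i z v * Complex.I_sq
    rw [omega123_eq_wedge, wedge_apply, wedge_apply, wedge_apply, Matrix.det_succ_row_zero,
      Matrix.det_succ_row_zero, Finset.mul_sum, ← Finset.sum_add_distrib, Finset.sum_eq_single 0]
    · have h1 := hj 0
      simp only [if_true] at h1
      rw [← h1]
      simp only [Matrix.of_apply, Fin.cons_zero, Fin.val_zero, pow_zero, one_mul]
      rw [add_mul, mul_assoc]
      rfl
    · intro j _ hj0
      have h1 := hj j
      rw [if_neg hj0] at h1
      have h2 : (Matrix.of fun i j => (Fin.cons b (fun i => omega p i z) : Fin 4 → Covector) j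
            ((Fin.cons (jMap p z v) stdFrame : Fin 4 → Coord) i)).submatrix Fin.succ j.succAbove =
          (Matrix.of fun i j => (Fin.cons b (fun i => omega p i z) : Fin 4 → Covector) j
            ((Fin.cons v stdFrame : Fin 4 → Coord) i)).submatrix Fin.succ j.succAbove := rfl
      rw [h2]
      simp only [Matrix.of_apply, Fin.cons_zero]
      linear_combination (-1) ^ (j : ℕ) * ((Matrix.of fun i j => (Fin.cons b
        (fun i => omega p i z) : Fin 4 → Covector) j
            ((Fin.cons v stdFrame : Fin 4 → Coord) i)).submatrix Fin.succ j.succAbove).det * h1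
    · simp
  rw [key, key, omega123_stdFrame] at e
  have hne : (1 + (p z : ℂ)) ≠ 0 := by exact_mod_cast h.one_add_ne z
  have hbv : b v = 0 := by
    have : 2 * b v * (1 + (p z : ℂ)) = 0 := by rw [← e]; simp
    simpa [hne] using this
  rw [hb_apply] at hbv
  linear_combination (-2 * Complex.I) * hbv + fderiv ℝ f z (jMap p z v) * Complex.I_sq

/-! ### The lattice -/

theorem exists_toCoord_eq_of_mem_lattice {γ : heisenbergGroup} (hγ : γ ∈ lattice) (j : Fin 3) :
    ∃ a : GaussianInt, toCoord γ j = GaussianInt.toComplex a := by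
  rw [lattice, Subgroup.mem_subgroupOf, MonoidHom.mem_range] at hγ
  obtain ⟨M, hM⟩ := hγ
  have e : ∀ k l, (γ : Matrix.SpecialLinearGroup (Fin 3) ℂ).1 k l =
      GaussianInt.toComplex (M.1 k l) := by
    intro k l
    rw [← hM]
    rfl
  fin_cases j
  · exact ⟨_, e 0 1⟩
  · exact ⟨_, e 1 2⟩
  · exact ⟨_, e 0 2⟩

theorem ofCoord_mem_lattice (a b c : GaussianInt) :
    ofCoord ![GaussianInt.toComplex a, GaussianInt.toComplex b, GaussianInt.toComplex c] ∈
      lattice := by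
  rw [lattice, Subgroup.mem_subgroupOf, MonoidHom.mem_range]
  refine ⟨⟨!![1, a, c; 0, 1, b; 0, 0, 1], by simp [Matrix.det_fin_three]⟩, ?_⟩
  ext i j
  change GaussianInt.toComplex ((!![1, a, c; 0, 1, b; 0, 0, 1] : Matrix (Fin 3) (Fin 3) _) i j) =
    heisMatrix _ i j
  fin_cases i <;> fin_cases j <;> simp [heisMatrix]

theorem exists_gaussianInt_norm_add_le (w : ℂ) :
    ∃ a : GaussianInt, ‖GaussianInt.toComplex a + w‖ ≤ 2 := by
  refine ⟨⟨-⌊w.re⌋, -⌊w.im⌋⟩, (Complex.norm_le_abs_re_add_abs_im _).trans ?_⟩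
  have h1 := Int.floor_le w.re
  have h2 := Int.lt_floor_add_one w.re
  have h3 := Int.floor_le w.im
  have h4 := Int.lt_floor_add_one w.im
  simp only [GaussianInt.toComplex_def]
  simp
  have h5 : |-(⌊w.re⌋ : ℝ) + w.re| ≤ 1 := abs_le.mpr ⟨by linarith, by linarith⟩
  have h6 : |-(⌊w.im⌋ : ℝ) + w.im| ≤ 1 := abs_le.mpr ⟨by linarith, by linarith⟩
  linarith

/-- The lattice is cocompact. -/
theorem exists_norm_leftTranslation_le (z : Coord) :
    ∃ γ ∈ lattice, ‖leftTranslation γ z‖ ≤ 2 := by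
  obtain ⟨a, ha⟩ := exists_gaussianInt_norm_add_le (z 0)
  obtain ⟨b, hb⟩ := exists_gaussianInt_norm_add_le (z 1)
  -- `c` is chosen after `a`, because the third coordinate of the translate contains `a z₂`.
  obtain ⟨c, hc⟩ := exists_gaussianInt_norm_add_le (z 2 + GaussianInt.toComplex a * z 1)
  refine ⟨_, ofCoord_mem_lattice a b c, ?_⟩
  rw [leftTranslation_apply, toCoord_ofCoord, pi_norm_le_iff_of_nonneg (by norm_num)]
  intro j
  fin_cases j
  · exact ha
  · exact hb
  · simpa [add_comm] using hc

theorem exists_bound_of_latticeInvariant {f : Coord → ℂ} (hf : Continuous f)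
    (hinv : ∀ γ ∈ lattice, ∀ z, f (leftTranslation γ z) = f z) : ∃ C, ∀ z, ‖f z‖ ≤ C := by
  obtain ⟨C, hC⟩ := (isCompact_closedBall (0 : Coord) 2).exists_bound_of_continuousOn
    hf.continuousOn
  refine ⟨C, fun z => ?_⟩
  obtain ⟨γ, hγ, hz⟩ := exists_norm_leftTranslation_le z
  rw [← hinv γ hγ z]
  exact hC _ (by simpa using hz)

theorem eq_of_proj_eq {p : Coord → ℝ} (hinv : ∀ γ ∈ lattice, ∀ z, p (leftTranslation γ z) = p z)
    {z w : Coord} (h : proj z = proj w) : p z = p w := by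
  have h1 : QuotientGroup.rightRel lattice (ofCoord z) (ofCoord w) := Quotient.exact h
  rw [QuotientGroup.rightRel_apply] at h1
  rw [← hinv _ h1 z, leftTranslation, inv_mul_cancel_right, toCoord_ofCoord]

theorem proj_leftTranslation {γ : heisenbergGroup} (hγ : γ ∈ lattice) (z : Coord) :
    proj (leftTranslation γ z) = proj z := by
  refine Quotient.sound ?_
  change QuotientGroup.rightRel lattice _ _
  rw [QuotientGroup.rightRel_apply, leftTranslation, ofCoord_toCoord, mul_inv_rev,
    mul_inv_cancel_left]
  exact inv_mem hγ

theorem proj_surjective : Function.Surjective proj := by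
  intro a
  induction a using Quotient.inductionOn with
  | h g => exact ⟨toCoord g, by rw [proj, ofCoord_toCoord]⟩

theorem exists_descent {p : Coord → ℝ} (hinv : ∀ γ ∈ lattice, ∀ z, p (leftTranslation γ z) = p z) :
    ∃ q : IwasawaManifold → ℝ, ∀ z, q (proj z) = p z :=
  ⟨fun a => p (Function.surjInv proj_surjective a), fun z =>
    eq_of_proj_eq hinv (Function.surjInv_eq proj_surjective (proj z))⟩

/-! ### Bounded holomorphic functions -/

/-- Liouville's theorem for solutions of the Cauchy-Riemann equations. -/
theorem eq_of_cauchyRiemann_of_bounded {g : ℂ → ℂ} (hg : Differentiable ℝ g)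
    (hcr : ∀ t, fderiv ℝ g t Complex.I = Complex.I * fderiv ℝ g t 1) {C : ℝ}
    (hC : ∀ t, ‖g t‖ ≤ C) (s t : ℂ) : g s = g t := by
  have hd : Differentiable ℂ g := fun t =>
    differentiableAt_complex_iff_differentiableAt_real.mpr ⟨hg t, by rw [hcr]; rfl⟩
  exact hd.apply_eq_apply_of_bounded
    (isBounded_iff_forall_norm_le.mpr ⟨C, by rintro _ ⟨y, rfl⟩; exact hC y⟩) s t

/-- The inverse of a primitive of a nonvanishing periodic function. -/
theorem exists_surjective_hasDerivAt_inv {q : ℝ → ℝ} (hq : Continuous q)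
    (hper : Function.Periodic q 1) (h0 : ∀ x, q x ≠ 0) :
    ∃ G : ℝ → ℝ, Function.Surjective G ∧ ∀ u, HasDerivAt G (q (G u))⁻¹ u := by
  have pos : ∀ r : ℝ → ℝ, Continuous r → Function.Periodic r 1 → (∀ x, 0 < r x) →
      ∃ G : ℝ → ℝ, Function.Surjective G ∧ ∀ u, HasDerivAt G (r (G u))⁻¹ u := by
    intro r hr hrper hpos
    obtain ⟨m, ⟨x₀, hm⟩, hmle⟩ := (hrper.compact_of_continuous one_ne_zero hr).exists_isLeast
      (Set.range_nonempty r)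
    have hm0 : 0 < m := hm ▸ hpos x₀
    let F : ℝ → ℝ := fun x => ∫ t in (0 : ℝ)..x, r t
    have hF : ∀ x, HasDerivAt F (r x) x := fun x => (hr.integral_hasStrictDerivAt 0 x).hasDerivAt
    have hFmono : StrictMono F := strictMono_of_deriv_pos fun x => by
      rw [(hF x).deriv]
      exact hpos x
    have hFcont : Continuous F := continuous_iff_continuousAt.mpr fun x => (hF x).continuousAt
    have hF0 : F 0 = 0 := intervalIntegral.integral_same
    -- With `m > 0` the minimum of `r`, the primitive grows at least linearly, so it maps onto the
    -- whole line.
    have hFm : Monotone fun x => F x - m * x := by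
      refine monotone_of_hasDerivAt_nonneg (f' := fun x => r x - m * 1)
        (fun x => (hF x).sub ((hasDerivAt_id x).const_mul m)) fun x => ?_
      have := hmle ⟨x, rfl⟩
      simpa using this
    have htop : Filter.Tendsto F Filter.atTop Filter.atTop := by
      refine Filter.tendsto_atTop_mono' _ ?_ (Filter.tendsto_id.const_mul_atTop hm0)
      filter_upwards [Filter.eventually_ge_atTop 0] with x hx
      have := hFm hx
      simp only [hF0] at this
      simp only [id]
      linarith
    have hbot : Filter.Tendsto F Filter.atBot Filter.atBot := by
      refine Filter.tendsto_atBot_mono' _ ?_ (Filter.tendsto_id.const_mul_atBot hm0)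
      filter_upwards [Filter.eventually_le_atBot 0] with x hx
      have := hFm hx
      simp only [hF0] at this
      simp only [id]
      linarith
    let e := hFmono.orderIsoOfSurjective F (hFcont.surjective htop hbot)
    refine ⟨e.symm, e.symm.surjective, fun u => ?_⟩
    exact HasDerivAt.of_local_left_inverse e.symm.continuous.continuousAt (hF _) (hpos _).ne'
      (Filter.Eventually.of_forall fun y => e.apply_symm_apply y)
  -- A continuous function without zeros keeps its sign; the negative case reduces to the positive
  -- one by reflecting the parameter.
  have sign : (∀ x, 0 < q x) ∨ ∀ x, 0 < -q x := by
    by_contra! hc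
    obtain ⟨⟨a, ha⟩, b, hb⟩ := hc
    obtain ⟨x, hx⟩ := mem_range_of_exists_le_of_exists_ge hq ⟨a, ha⟩ ⟨b, by linarith⟩
    exact h0 x hx
  rcases sign with hs | hs
  · exact pos q hq hper hs
  · obtain ⟨H, hH, hH'⟩ := pos (fun x => -q x) hq.neg (fun x => by simp only [hper x]) hs
    refine ⟨fun u => H (-u), hH.comp neg_surjective, fun u => ?_⟩
    have := (hH' (-u)).comp u (hasDerivAt_neg u)
    rw [inv_neg, neg_mul_neg, mul_one] at this
    exact this

/-- Holomorphic functions on the (compact) Iwasawa manifold are constant. -/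
theorem IsProfile.eq_of_holomorphic {p : Coord → ℝ} (h : IsProfile p)
    (hinv : ∀ γ ∈ lattice, ∀ z, p (leftTranslation γ z) = p z) {f : Coord → ℂ}
    (hf : Differentiable ℝ f)
    (hfinv : ∀ γ ∈ lattice, ∀ z, f (leftTranslation γ z) = f z)
    (hol : ∀ z v, fderiv ℝ f z (jMap p z v) = Complex.I * fderiv ℝ f z v) (z : Coord) :
    f z = f 0 := by
  obtain ⟨C, hC⟩ := exists_bound_of_latticeInvariant hf.continuous hfinv
  -- Along an entire `J`-holomorphic curve, `f` is a bounded entire function, hence constant.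
  have curve : ∀ (g : ℂ → Coord) (g' : ℂ → ℂ →L[ℝ] Coord), (∀ t, HasFDerivAt g (g' t) t) →
      (∀ t, fderiv ℝ f (g t) (g' t Complex.I) = Complex.I * fderiv ℝ f (g t) (g' t 1)) →
      ∀ s t, f (g s) = f (g t) := by
    intro g g' hg hcr s t
    have hd : ∀ t, HasFDerivAt (fun t => f (g t)) ((fderiv ℝ f (g t)).comp (g' t)) t := fun t =>
      (hf (g t)).hasFDerivAt.comp t (hg t)
    refine eq_of_cauchyRiemann_of_bounded (fun t => (hd t).differentiableAt) (fun t => ?_)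
      (fun t => hC (g t)) s t
    rw [(hd t).fderiv]
    exact hcr t
  have line : ∀ j : Fin 3, (∀ y, jMap p y (Pi.single j 1) = Pi.single j Complex.I) →
      ∀ y t, f (Function.update y j t) = f y := by
    intro j hj y t
    have := curve (Function.update y j) (fun _ => .pi (Pi.single j (.id ℝ ℂ)))
      (hasFDerivAt_update y) (fun t => by
        have := hol (Function.update y j t) (Pi.single j 1)
        rw [hj] at this
        have e : ∀ w : ℂ, ContinuousLinearMap.pi (Pi.single j (.id ℝ ℂ)) w =
            (Pi.single j w : Coord) := by
          intro w
          ext k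
          by_cases hk : k = j
          · subst hk
            simp
          · simp [hk]
        rwa [e, e]) t (y j)
    rwa [Function.update_eq_self] at this
  -- Moving `z₃` and `z₁` to `0` costs nothing. With `z₁ = 0`, `J` preserves the `z₂`-direction, so
  -- the remaining curve can stay in that coordinate line.
  have hz : f z = f (Pi.single 1 (z 1)) := by
    rw [← line 2 (fun y => by
        rw [jMap_apply]; ext j; fin_cases j <;> simp) z 0,
      ← line 0 (fun y => by
        rw [jMap_apply]; ext j; fin_cases j <;> simp) _ 0]
    congr 1
    ext j
    fin_cases j <;> simp
  let P : ℝ → ℝ := fun t => p (Pi.single 1 (t : ℂ))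
  have hPcont : Continuous P := by
    refine h.smooth.continuous.comp ?_
    exact (ContinuousLinearMap.single ℝ (fun _ : Fin 3 => ℂ) 1).continuous.comp
      Complex.continuous_ofReal
  have hPper : Function.Periodic P 1 := by
    intro t
    have := hinv _ (ofCoord_mem_lattice 0 1 0) (Pi.single 1 (t : ℂ))
    rw [leftTranslation_apply, toCoord_ofCoord] at this
    refine Eq.trans ?_ this
    exact h.dependsOn _ _ (by simp [add_comm])
  -- On the `z₂`-line `J ∂_{x₂} = ((1 + P) / (1 - P)) ∂_{y₂}`. The curve `G(Re t) + i Im t` is thus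
  -- `J`-holomorphic when `G' = (1 - P) / (1 + P)` at `G`; surjectivity of `G` makes it cover the
  -- line.
  obtain ⟨G, hGs, hG⟩ := exists_surjective_hasDerivAt_inv
    (q := fun t => (1 + P t) / (1 - P t))
    ((continuous_const.add hPcont).div (continuous_const.sub hPcont)
      fun t => h.one_sub_ne _)
    (fun t => by simp only [hPper t])
    (fun t => div_ne_zero (h.one_add_ne _) (h.one_sub_ne _))
  let g : ℂ → Coord := fun t => Pi.single 1 ((G t.re : ℂ) + t.im * Complex.I)
  have hg1 : ∀ w, ∃ t, g t = Pi.single 1 w := by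
    intro w
    obtain ⟨u, hu⟩ := hGs w.re
    refine ⟨⟨u, w.im⟩, ?_⟩
    simp only [g, hu, Complex.re_add_im]
  obtain ⟨s, hs⟩ := hg1 (z 1)
  obtain ⟨t, ht⟩ := hg1 0
  rw [hz, ← hs, ← Pi.single_zero (M := fun _ : Fin 3 => ℂ) 1, ← ht]
  let g' : ℂ → ℂ →L[ℝ] Coord := fun t => (ContinuousLinearMap.single ℝ (fun _ : Fin 3 => ℂ) 1).comp
    (Complex.ofRealCLM.comp (((1 + P (G t.re)) / (1 - P (G t.re)))⁻¹ • Complex.reCLM) +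
      (Complex.ofRealCLM.comp Complex.imCLM).smulRight Complex.I)
  refine curve g g' (fun t => ?_) (fun t => ?_) s t
  · refine (ContinuousLinearMap.single ℝ (fun _ : Fin 3 => ℂ) 1).hasFDerivAt.comp t ?_
    refine HasFDerivAt.add ?_ ?_
    · exact Complex.ofRealCLM.hasFDerivAt.comp t
        ((hG t.re).comp_hasFDerivAt t Complex.reCLM.hasFDerivAt)
    · exact ((Complex.ofRealCLM.comp Complex.imCLM).hasFDerivAt (x := t)).mul_const' Complex.I
  · have h1 := hol (g t) (Pi.single 1 Complex.I)
    have hp : p (g t) = P (G t.re) := h.dependsOn _ _ (by simp [g])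
    have e1 : jMap p (g t) (Pi.single 1 Complex.I) =
        (-((1 - P (G t.re)) / (1 + P (G t.re)))) • (Pi.single 1 1 : Coord) := by
      rw [jMap_apply, rotate_eq, hp]
      ext j
      fin_cases j <;> simp [g]
    have e2 : g' t Complex.I = Pi.single 1 Complex.I := by simp [g']
    have e3 : g' t 1 = ((1 - P (G t.re)) / (1 + P (G t.re))) • (Pi.single 1 1 : Coord) := by
      ext j
      fin_cases j <;> simp [g']
    rw [e1, neg_smul, map_neg, ← e3] at h1
    rw [e2]
    linear_combination Complex.I * h1 + fderiv ℝ f (g t) (Pi.single 1 Complex.I) * Complex.I_sq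

/-! ### Pluricanonical sections -/

namespace AlmostComplexStructure

theorem tpow_smul (l : ℕ) (c : ℂ) (α : Form 3) : tpow l (c • α) = c ^ l • tpow l α := by
  rw [tpow, MultilinearMap.map_smul_univ (PiTensorProduct.tprod ℂ) (fun _ : Fin l => c)
    (fun _ => α)]
  simp [tpow]

theorem map_tpow (l : ℕ) (T : Form 3 →ₗ[ℂ] Form 3) (α : Form 3) :
    PiTensorProduct.map (fun _ : Fin l => T) (tpow l α) = tpow l (T α) :=
  PiTensorProduct.map_tprod _ _

theorem tpow_ne_zero (l : ℕ) {α : Form 3} {v : Fin 3 → Coord} (h : α v ≠ 0) : tpow l α ≠ 0 := by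
  intro h0
  let ev : Form 3 →ₗ[ℂ] ℂ :=
    { toFun := fun β => β v
      map_add' := fun _ _ => rfl
      map_smul' := fun _ _ => rfl }
  have h1 : PiTensorProduct.lift ((MultilinearMap.mkPiAlgebra ℂ (Fin l) ℂ).compLinearMap
      fun _ => ev) (tpow l α) = α v ^ l := by
    rw [tpow, PiTensorProduct.lift.tprod]
    simp [ev]
  rw [h0, map_zero] at h1
  exact pow_ne_zero l h h1.symm

end AlmostComplexStructure

open AlmostComplexStructure

theorem contDiff_apply_form {k : ℕ} {n : WithTop ℕ∞} {α : Coord → Form k} {U : Set Coord}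
    (h : ContDiffOn ℝ n α U) (v : Fin k → Coord) : ContDiffOn ℝ n (fun z => α z v) U :=
  (ContinuousAlternatingMap.apply ℝ Coord ℂ v).contDiff.comp_contDiffOn h

theorem IsProfile.isLocalFrame {p : Coord → ℝ} (h : IsProfile p) :
    h.acs.IsLocalFrame Set.univ (trivialization p) :=
  ⟨isOpen_univ, h.contDiff_trivialization.contDiffOn,
    fun z _ => ⟨h.trivialization_mem z, h.trivialization_ne z⟩⟩

/-- If `Ω = g σ` in a local frame, then `dΩ = 0` gives `dg ∧ σ = -g dσ`. Hence `d(g^l σ) = (1 - l)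
g^l dσ`, which the correction term `(l - 1) g^l ∂̄σ` cancels. -/
theorem IsProfile.tpow_trivialization_mem {p : Coord → ℝ} (h : IsProfile p)
    (hinv : ∀ γ ∈ lattice, ∀ z, p (leftTranslation γ z) = p z) (l : ℕ) :
    (fun z => tpow l (trivialization p z)) ∈ h.acs.pluricanonicalSections l := by
  refine ⟨fun γ hγ z => ?_, fun U σ hσ => ?_⟩
  · rw [map_tpow, pullback_trivialization (hinv γ hγ z)]
  have hσne : ∀ z ∈ U, σ z stdFrame ≠ 0 := by
    intro z hz h0
    have h1 := h.eq_smul_trivialization (hσ.2.2 z hz).1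
    rw [h0, zero_div] at h1
    exact (hσ.2.2 z hz).2 (h1.trans (by ext v; simp))
  let g : Coord → ℂ := fun z => trivialization p z stdFrame / σ z stdFrame
  have hgσ : ∀ z ∈ U, trivialization p z = g z • σ z := by
    intro z hz
    conv_rhs => rw [h.eq_smul_trivialization (hσ.2.2 z hz).1]
    rw [smul_smul, div_mul_div_comm, mul_comm, div_self
      (mul_ne_zero (hσne z hz) (h.trivialization_stdFrame_ne z)), one_smul]
  have hg : ContDiffOn ℝ ∞ g U :=
    ((contDiff_apply_form h.contDiff_trivialization.contDiffOn stdFrame).mul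
      ((contDiff_apply_form hσ.2.1 stdFrame).inv hσne)).congr fun z _ => div_eq_mul_inv _ _
  refine ⟨fun z => g z ^ l, hg.pow l, fun z hz => ?_, fun z hz v => ?_⟩
  · change tpow l (trivialization p z) = g z ^ l • tpow l (σ z)
    rw [hgσ z hz, tpow_smul]
  have hU := hσ.1.mem_nhds hz
  have hσd : DifferentiableAt ℝ σ z := (hσ.2.1.contDiffAt hU).differentiableAt (by simp)
  have hgd : DifferentiableAt ℝ g z := (hg.contDiffAt hU).differentiableAt (by simp)
  have e1 : g z • extDeriv σ z + covectorWedge (fderiv ℝ g z) (σ z) = 0 := by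
    rw [← extDeriv_smul_form hgd hσd, ← h.extDeriv_trivialization z]
    refine Filter.EventuallyEq.extDeriv_eq ?_
    filter_upwards [hU] with y hy
    exact (hgσ y hy).symm
  have e2 : extDeriv (fun y => g y ^ l • σ y) z = ((1 - (l : ℂ)) * g z ^ l) • extDeriv σ z := by
    have hpow : HasFDerivAt (fun y => g y ^ l) ((l • g z ^ (l - 1)) • fderiv ℝ g z) z :=
      hgd.hasFDerivAt.pow l
    rw [extDeriv_smul_form hpow.differentiableAt hσd, hpow.fderiv,
      ← Nat.cast_smul_eq_nsmul ℂ, smul_eq_mul, smul_covectorWedge, eq_neg_of_add_eq_zero_right e1]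
    -- At `l = 0` the exponent `l - 1` is truncated, but its coefficient `l` vanishes.
    rcases l with _ | l
    · simp
    · rw [smul_neg, smul_smul, ← sub_eq_add_neg, ← sub_smul]
      congr 1
      rw [Nat.add_sub_cancel]
      ring
  simp only [dbar]
  rw [e2, bidegreePart_smul]
  ring

/-- In the global frame `Ω` the correction term vanishes, so the coefficient is holomorphic; it is
lattice-invariant because `Ω` is, hence constant. -/
theorem IsProfile.pluricanonicalSections_le {p : Coord → ℝ} (h : IsProfile p)
    (hinv : ∀ γ ∈ lattice, ∀ z, p (leftTranslation γ z) = p z) (l : ℕ) :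
    h.acs.pluricanonicalSections l ≤
      Submodule.span ℂ {fun z => tpow l (trivialization p z)} := by
  rintro s ⟨hs, hs'⟩
  obtain ⟨f, hf, hsf, hf0⟩ := hs' Set.univ (trivialization p) h.isLocalFrame
  have hfd : Differentiable ℝ f := (contDiffOn_univ.mp hf).differentiable (by simp)
  have hfinv : ∀ γ ∈ lattice, ∀ z, f (leftTranslation γ z) = f z := by
    intro γ hγ z
    have h1 := hs γ hγ z
    rw [hsf _ trivial, hsf _ trivial, map_smul, map_tpow,
      pullback_trivialization (hinv γ hγ z)] at h1
    exact smul_left_injective ℂ (tpow_ne_zero l (h.trivialization_stdFrame_ne z)) h1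
  have hol : ∀ z v, fderiv ℝ f z (jMap p z v) = Complex.I * fderiv ℝ f z v := by
    intro z
    refine h.fderiv_jMap_of_dbar_eq_zero (hfd z) fun v => ?_
    have := hf0 z trivial v
    rwa [h.dbar_trivialization, mul_zero, add_zero] at this
  rw [Submodule.mem_span_singleton]
  refine ⟨f 0, ?_⟩
  funext z
  rw [hsf z trivial, h.eq_of_holomorphic hinv hfd hfinv hol z]
  rfl

theorem IsProfile.rank_pluricanonicalSections {p : Coord → ℝ} (h : IsProfile p)
    (hinv : ∀ γ ∈ lattice, ∀ z, p (leftTranslation γ z) = p z) (l : ℕ) :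
    Module.rank ℂ (h.acs.pluricanonicalSections l) = 1 := by
  let Ω : h.acs.pluricanonicalSections l := ⟨_, h.tpow_trivialization_mem hinv l⟩
  have hb : Function.Bijective (LinearMap.toSpanSingleton ℂ (h.acs.pluricanonicalSections l) Ω) := by
    constructor
    · intro a b hab
      have h1 : a • tpow l (trivialization p 0) = b • tpow l (trivialization p 0) :=
        congrFun (congrArg Subtype.val hab) 0
      exact smul_left_injective ℂ (tpow_ne_zero l (h.trivialization_stdFrame_ne 0)) h1
    · intro s
      obtain ⟨a, ha⟩ := Submodule.mem_span_singleton.mp (h.pluricanonicalSections_le hinv l s.2)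
      exact ⟨a, Subtype.ext ha⟩
  rw [← (LinearEquiv.ofBijective _ hb).rank_eq, Module.rank_self]

theorem IsProfile.kodairaDimension_eq_zero {p : Coord → ℝ} (h : IsProfile p)
    (hinv : ∀ γ ∈ lattice, ∀ z, p (leftTranslation γ z) = p z) : h.acs.kodairaDimension = 0 := by
  rw [kodairaDimension, if_neg]
  · simp only [h.rank_pluricanonicalSections hinv]
    simp
  · intro hc
    have h1 := h.rank_pluricanonicalSections hinv 1
    rw [hc 1 le_rfl] at h1
    simp at h1

/-! ### The complex frame -/

/-- The complex vector `(1 ⊗ u - i ⊗ iu) / 2`. -/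
def holVector (u : Coord) : ComplexVector :=
  (1 / 2 : ℂ) • ((1 : ℂ) ⊗ₜ[ℝ] u - Complex.I ⊗ₜ[ℝ] (Complex.I • u))

theorem tmul_real_smul (a : ℂ) (r : ℝ) (u : Coord) :
    a ⊗ₜ[ℝ] (r • u) = (r : ℂ) • (a ⊗ₜ[ℝ] u) := by
  rw [TensorProduct.tmul_smul, TensorProduct.smul_tmul', TensorProduct.smul_tmul',
    Complex.real_smul, smul_eq_mul]

theorem I_smul_one_tmul (u : Coord) :
    Complex.I • ((1 : ℂ) ⊗ₜ[ℝ] u) = Complex.I ⊗ₜ[ℝ] u := by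
  rw [TensorProduct.smul_tmul', smul_eq_mul, mul_one]

theorem I_smul_I_tmul (u : Coord) :
    Complex.I • (Complex.I ⊗ₜ[ℝ] u) = -((1 : ℂ) ⊗ₜ[ℝ] u) := by
  rw [TensorProduct.smul_tmul', smul_eq_mul, Complex.I_mul_I, TensorProduct.neg_tmul]

theorem holVector_add (u v : Coord) : holVector (u + v) = holVector u + holVector v := by
  simp only [holVector, smul_add, TensorProduct.tmul_add]
  rw [← smul_add]
  congr 1
  abel

theorem holVector_real_smul (r : ℝ) (u : Coord) : holVector (r • u) = (r : ℂ) • holVector u := by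
  rw [holVector, holVector, smul_comm Complex.I r u, tmul_real_smul, tmul_real_smul, ← smul_sub,
    smul_comm]

theorem holVector_I_smul (u : Coord) : holVector (Complex.I • u) = Complex.I • holVector u := by
  rw [holVector, holVector, smul_smul, Complex.I_mul_I, smul_comm Complex.I (1 / 2 : ℂ),
    smul_sub Complex.I, I_smul_one_tmul, I_smul_I_tmul, neg_one_smul, TensorProduct.tmul_neg]
  congr 1
  abel

/-- Complex linearity lets `∂_{z₂} + z₁ ∂_{z₃}` be written as the `holVector` of a single real
tangent vector. -/
theorem smul_holVector (c : ℂ) (u : Coord) : c • holVector u = holVector (c • u) := by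
  have e1 : c • u = c.re • u + c.im • (Complex.I • u) := by
    ext j
    simp
    linear_combination (-u j) * Complex.re_add_im c
  rw [e1, holVector_add, holVector_real_smul, holVector_real_smul, holVector_I_smul, smul_smul,
    ← add_smul, Complex.re_add_im]

theorem partialZ_eq (j : Fin 3) : partialZ j = holVector (Pi.single j 1) := by
  have : (Pi.single j Complex.I : Coord) = Complex.I • Pi.single j 1 := by
    rw [← Pi.single_smul, smul_eq_mul, mul_one]
  rw [partialZ, holVector, this]

theorem conjVector_holVector (u : Coord) : conjVector (holVector u) =
    (1 / 2 : ℂ) • ((1 : ℂ) ⊗ₜ[ℝ] u + Complex.I ⊗ₜ[ℝ] (Complex.I • u)) := by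
  have e : (starRingEnd ℂ) (2 : ℂ) = 2 := Complex.conj_ofNat 2
  rw [holVector, smul_sub, smul_add, TensorProduct.smul_tmul', TensorProduct.smul_tmul', map_sub]
  simp [conjVector, TensorProduct.neg_tmul, e]

/-- Twice the real part of `ψ`. -/
def psiRe (p : Coord → ℝ) (j : Fin 3) (z : Coord) : Coord :=
  ![Pi.single 0 1, (1 + p z)⁻¹ • (Pi.single 1 1 + z 0 • Pi.single 2 1), Pi.single 2 1] j

theorem xi_one_eq (z : Coord) :
    xi 1 z = holVector (Pi.single 1 1 + z 0 • Pi.single 2 1) := by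
  change partialZ 1 + z 0 • partialZ 2 = _
  rw [partialZ_eq, partialZ_eq, smul_holVector, holVector_add]

theorem jMap_single_zero (p : Coord → ℝ) (z : Coord) :
    jMap p z (Pi.single 0 1) = Complex.I • Pi.single 0 1 := by
  rw [jMap_apply]
  ext j
  fin_cases j <;> simp

theorem jMap_single_two (p : Coord → ℝ) (z : Coord) :
    jMap p z (Pi.single 2 1) = Complex.I • Pi.single 2 1 := by
  rw [jMap_apply]
  ext j
  fin_cases j <;> simp

/-- The form `(u - i J u) / 2` makes the type of `ψ_j` and its pairing with `ω^k` consequences of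
`J² = -1` and `ω^k(J u) = i ω^k(u)`. For `ψ₂`, twice the real part is `B (1 - p) = (1 + p)⁻¹` times
the vector underlying `ξ₂`. -/
theorem IsProfile.psi_eq {p : Coord → ℝ} (h : IsProfile p) (j : Fin 3) (z : Coord) :
    psi p j z = (1 / 2 : ℂ) • ((1 : ℂ) ⊗ₜ[ℝ] psiRe p j z -
      Complex.I ⊗ₜ[ℝ] (jMap p z (psiRe p j z))) := by
  fin_cases j
  · change partialZ 0 = (1 / 2 : ℂ) • ((1 : ℂ) ⊗ₜ[ℝ] (Pi.single 0 1 : Coord) -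
      Complex.I ⊗ₜ[ℝ] (jMap p z (Pi.single 0 1)))
    rw [partialZ_eq, holVector, jMap_single_zero]
  · have h1 := h.one_sub_ne z
    have h2 := h.one_add_ne z
    have h3 := h.one_sub_sq_ne z
    set u : Coord := Pi.single 1 1 + z 0 • Pi.single 2 1 with hu
    have hJ : jMap p z ((1 + p z)⁻¹ • u) = (1 - p z)⁻¹ • (Complex.I • u) := by
      refine h.omega_injective (z := z) fun j => ?_
      rw [h.omega_jMap]
      have hc : (1 + (p z : ℂ)) ≠ 0 := by exact_mod_cast h2
      have hc' : (1 - (p z : ℂ)) ≠ 0 := by exact_mod_cast h1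
      fin_cases j
      · simp [hu]
      · simp [hu]
        field_simp
        ring
      · simp [hu]
        ring
    change (((1 - p z ^ 2)⁻¹ : ℝ) : ℂ) • (xi 1 z - (p z : ℂ) • conjVector (xi 1 z)) =
      (1 / 2 : ℂ) • ((1 : ℂ) ⊗ₜ[ℝ] ((1 + p z)⁻¹ • u) -
        Complex.I ⊗ₜ[ℝ] (jMap p z ((1 + p z)⁻¹ • u)))
    have e1 : (1 + p z)⁻¹ = (1 - p z ^ 2)⁻¹ * (1 - p z) := by
      field_simp
      ring
    have e2 : (1 - p z)⁻¹ = (1 - p z ^ 2)⁻¹ * (1 + p z) := by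
      field_simp
      ring
    rw [hJ, e1, e2, xi_one_eq, conjVector_holVector, holVector, tmul_real_smul,
      tmul_real_smul]
    push_cast
    module
  · change partialZ 2 = (1 / 2 : ℂ) • ((1 : ℂ) ⊗ₜ[ℝ] (Pi.single 2 1 : Coord) -
      Complex.I ⊗ₜ[ℝ] (jMap p z (Pi.single 2 1)))
    rw [partialZ_eq, holVector, jMap_single_two]

theorem IsProfile.baseChange_psi {p : Coord → ℝ} (h : IsProfile p) (j : Fin 3) (z : Coord) :
    (h.acs.J z : Coord →ₗ[ℝ] Coord).baseChange ℂ (psi p j z) = Complex.I • psi p j z := by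
  have hJJ : jMap p z (jMap p z (psiRe p j z)) = -psiRe p j z := h.acs.sq z _
  rw [h.psi_eq, map_smul, map_sub, LinearMap.baseChange_tmul, LinearMap.baseChange_tmul,
    smul_comm Complex.I (1 / 2 : ℂ), smul_sub Complex.I, I_smul_one_tmul, I_smul_I_tmul, h.acs_J]
  change (1 / 2 : ℂ) • ((1 : ℂ) ⊗ₜ[ℝ] jMap p z (psiRe p j z) -
    Complex.I ⊗ₜ[ℝ] jMap p z (jMap p z (psiRe p j z))) = _
  rw [hJJ, TensorProduct.tmul_neg]
  congr 1
  abel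

theorem IsProfile.evalC_omega_psi {p : Coord → ℝ} (h : IsProfile p) (j k : Fin 3) (z : Coord) :
    evalC (omega p j z) (psi p k z) = if j = k then 1 else 0 := by
  have e : evalC (omega p j z) (psi p k z) = omega p j z (psiRe p k z) := by
    rw [h.psi_eq, map_smul, map_sub, evalC, LinearMap.liftBaseChange_tmul,
      LinearMap.liftBaseChange_tmul]
    change (1 / 2 : ℂ) * (1 * omega p j z (psiRe p k z) -
      Complex.I * omega p j z (jMap p z (psiRe p k z))) = _
    rw [h.omega_jMap]
    linear_combination (-1 / 2 * omega p j z (psiRe p k z)) * Complex.I_sq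
  have hc : (1 + (p z : ℂ)) ≠ 0 := by exact_mod_cast h.one_add_ne z
  rw [e]
  fin_cases j <;> fin_cases k <;> simp [psiRe]
  · field_simp
  · ring

/-! ### The structure equations -/

theorem IsProfile.extDeriv_omega_one_eq {p : Coord → ℝ} (h : IsProfile p) (z : Coord) :
    extDeriv (fun y => wedge ![omega p 1 y]) z =
      (((fderiv ℝ p z (Pi.single 1 1) / 2 : ℝ) : ℂ) * (1 - (p z : ℂ) ^ 2)⁻¹) •
        wedge ![omega p 1 z, conjCovector (omega p 1 z)] := by
  have hne : (1 - (p z : ℂ) ^ 2) ≠ 0 := by exact_mod_cast h.one_sub_sq_ne z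
  rw [extDeriv_omega_one h]
  have e1 : wedge ![dx2, conjCovector (dz 1)] =
      (1 / 2 : ℂ) • wedge ![dz 1, conjCovector (dz 1)] := by
    ext v
    simp [wedge_apply, Matrix.det_fin_two, Complex.re_eq_add_conj]
    ring
  have e2 : wedge ![omega p 1 z, conjCovector (omega p 1 z)] =
      (1 - (p z : ℂ) ^ 2) • wedge ![dz 1, conjCovector (dz 1)] := by
    ext v
    simp [wedge_apply, Matrix.det_fin_two]
    ring
  rw [e1, e2, smul_smul, smul_smul, mul_assoc _ _ (1 - (p z : ℂ) ^ 2), inv_mul_cancel₀ hne]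
  congr 1
  push_cast
  ring

theorem IsProfile.extDeriv_omega_two_eq {p : Coord → ℝ} (h : IsProfile p) (z : Coord) :
    extDeriv (fun y => wedge ![omega p 2 y]) z =
      -(((1 - (p z : ℂ) ^ 2)⁻¹) • (wedge ![omega p 0 z, omega p 1 z] -
        (p z : ℂ) • wedge ![omega p 0 z, conjCovector (omega p 1 z)])) := by
  have hne : (1 - (p z : ℂ) ^ 2) ≠ 0 := by exact_mod_cast h.one_sub_sq_ne z
  have e : wedge ![omega p 0 z, omega p 1 z] -
        (p z : ℂ) • wedge ![omega p 0 z, conjCovector (omega p 1 z)] =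
      (1 - (p z : ℂ) ^ 2) • wedge ![dz 0, dz 1] := by
    ext v
    simp [wedge_apply, Matrix.det_fin_two]
    ring
  rw [extDeriv_omega_two, e, smul_smul, inv_mul_cancel₀ hne, one_smul]

/-! ### The sine profile -/

theorem wedge_omega_conj_ne_zero {p : Coord → ℝ} (h : IsProfile p) (z : Coord) :
    wedge ![omega p 0 z, omega p 1 z, omega p 2 z, conjCovector (omega p 1 z)]
      ![Pi.single 0 1, Pi.single 1 1, Pi.single 1 Complex.I, Pi.single 2 1] ≠ 0 := by
  have hne : (1 - (p z : ℂ) ^ 2) ≠ 0 := by exact_mod_cast h.one_sub_sq_ne z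
  rw [wedge_omega_conj]
  simp [wedge_apply, Matrix.det_succ_row_zero, Fin.sum_univ_succ, Fin.succAbove]
  exact hne

theorem hasFDerivAt_sin_re {c : ℝ} {s : Coord → ℝ} (hs : ∀ z, s z = Real.sin (c * (z 1).re))
    (z : Coord) : HasFDerivAt s (Real.cos (c * (z 1).re) • c • reCoord) z := by
  rw [show s = fun z => Real.sin (c * reCoord z) from funext hs]
  exact (Real.hasDerivAt_sin _).comp_hasFDerivAt z (reCoord.hasFDerivAt.const_mul c)

theorem isProfile_sin {A c : ℝ} {s p : Coord → ℝ} (hA : |A| < 1)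
    (hs : ∀ z, s z = Real.sin (c * (z 1).re)) (hp : ∀ z, p z = A * s z) : IsProfile p := by
  have hz : ContDiff ℝ ∞ (fun z : Coord => (z 1).re) := reCoord.contDiff
  have e : p = fun z => A * Real.sin (c * (z 1).re) := by
    funext z
    rw [hp, hs]
  refine ⟨?_, fun z w h => by rw [hp, hp, hs, hs, h], fun z => ?_⟩
  · rw [e]
    exact contDiff_const.mul (Real.contDiff_sin.comp (contDiff_const.mul hz))
  · rw [hp, hs, abs_mul]
    exact ((mul_le_of_le_one_right (abs_nonneg A) (Real.abs_sin_le_one _)).trans_lt hA).ne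

theorem sin_profile_leftTranslation {A c : ℝ} {s p : Coord → ℝ}
    (hs : ∀ z, s z = Real.sin (c * (z 1).re)) (hp : ∀ z, p z = A * s z) {k : ℤ}
    (hc : c = 2 * Real.pi * k) : ∀ γ ∈ lattice, ∀ z, p (leftTranslation γ z) = p z := by
  intro γ hγ z
  obtain ⟨a, ha⟩ := exists_toCoord_eq_of_mem_lattice hγ 1
  have e : (leftTranslation γ z 1).re = a.re + (z 1).re := by
    rw [leftTranslation_apply]
    simp [ha]
  have e2 : 2 * Real.pi * k * (a.re + (z 1).re) =
      2 * Real.pi * k * (z 1).re + ((k * a.re : ℤ) : ℝ) * (2 * Real.pi) := by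
    push_cast
    ring
  rw [hp, hp, hs, hs, e, hc, e2, Real.sin_add_int_mul_two_pi]

theorem sin_profile_ne {A c : ℝ} {s p : Coord → ℝ}
    (hs : ∀ z, s z = Real.sin (c * (z 1).re)) (hp : ∀ z, p z = A * s z) (hA : A ≠ 0) {k : ℤ}
    (hk : k ≠ 0) (hc : c = 2 * Real.pi * k) :
    p (Pi.single 1 ((1 / (4 * k) : ℝ) : ℂ)) ≠ p 0 := by
  have hk' : (k : ℝ) ≠ 0 := by exact_mod_cast hk
  -- At `x₂ = 1 / (4k)` the sine equals `1`, so `p` takes the value `A` there and `0` at the origin.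
  have e : 2 * Real.pi * k * (1 / (4 * k)) = Real.pi / 2 := by
    field_simp
    ring
  rw [hp, hp, hs, hs, hc, Pi.single_eq_same, Complex.ofReal_re, e]
  simpa using hA

end Iwasawa

end

/-! ### Assembly of (a) and (b) -/

theorem mainTheorem2 :
    (∀ p : Iwasawa.IwasawaManifold → ℝ,
      ContDiff ℝ ∞ (fun z => p (Iwasawa.proj z)) →
      (∀ z w : Iwasawa.Coord, (z 1).re = (w 1).re → p (Iwasawa.proj z) = p (Iwasawa.proj w)) →
      (∃ a b, p a ≠ p b) →
      (∀ a, |p a| ≠ 1) →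
      ∃ X : Iwasawa.AlmostComplexStructure,
        (∀ Y : Iwasawa.AlmostComplexStructure,
          Y.IsCoframe (Iwasawa.omega fun z => p (Iwasawa.proj z)) ↔ Y = X) ∧
        (∀ j, Iwasawa.FormIsLatticeInvariant
          (fun z => Iwasawa.wedge ![Iwasawa.omega (fun y => p (Iwasawa.proj y)) j z])) ∧
        X.IsLatticeInvariant ∧
        ¬ X.IsLeftInvariant ∧
        X.IsIntegrable ∧
        X.IsHolomorphicTrivialization (fun z =>
          (((1 - p (Iwasawa.proj z))⁻¹ : ℝ) : ℂ) •
            Iwasawa.omega123 (fun y => p (Iwasawa.proj y)) z) ∧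
        X.kodairaDimension = 0) ∧
    (∀ (A c : ℝ) (s p B : Iwasawa.Coord → ℝ), |A| < 1 →
      (∀ z, s z = Real.sin (c * (z 1).re)) →
      (∀ z, p z = A * s z) →
      (∀ z, B z = (1 - A ^ 2 * s z ^ 2)⁻¹) →
      ∃ X : Iwasawa.AlmostComplexStructure,
        (∀ Y : Iwasawa.AlmostComplexStructure, Y.IsCoframe (Iwasawa.omega p) ↔ Y = X) ∧
        (∀ j z, (X.J z : Iwasawa.Coord →ₗ[ℝ] Iwasawa.Coord).baseChange ℂ (Iwasawa.psi p j z) =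
          Complex.I • Iwasawa.psi p j z) ∧
        (∀ j k z, Iwasawa.evalC (Iwasawa.omega p j z) (Iwasawa.psi p k z) =
          if j = k then 1 else 0) ∧
        (∀ z, extDeriv (fun y => Iwasawa.wedge ![Iwasawa.omega p 0 y]) z = 0) ∧
        (∀ z, extDeriv (fun y => Iwasawa.wedge ![Iwasawa.omega p 1 y]) z =
          ((A : ℂ) * B z * Iwasawa.dZ2 s z) •
            Iwasawa.wedge ![Iwasawa.omega p 1 z, Iwasawa.conjCovector (Iwasawa.omega p 1 z)]) ∧
        (∀ z, extDeriv (fun y => Iwasawa.wedge ![Iwasawa.omega p 2 y]) z =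
          -((B z : ℂ) • (Iwasawa.wedge ![Iwasawa.omega p 0 z, Iwasawa.omega p 1 z] -
            (p z : ℂ) • Iwasawa.wedge
              ![Iwasawa.omega p 0 z, Iwasawa.conjCovector (Iwasawa.omega p 1 z)]))) ∧
        X.IsIntegrable ∧
        (∀ z v, X.dbar 3 (Iwasawa.omega123 p) z v =
          ((A : ℂ) * B z * Iwasawa.dZ2 s z) *
            Iwasawa.wedge ![Iwasawa.omega p 0 z, Iwasawa.omega p 1 z, Iwasawa.omega p 2 z,
              Iwasawa.conjCovector (Iwasawa.omega p 1 z)] v) ∧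
        (A ≠ 0 → c ≠ 0 → ∃ z v, X.dbar 3 (Iwasawa.omega123 p) z v ≠ 0) ∧
        (∀ z v, X.dbar 3 (fun y => (((1 - p y)⁻¹ : ℝ) : ℂ) • Iwasawa.omega123 p y) z v = 0) ∧
        (∀ k : ℤ, c = 2 * Real.pi * k →
          (∃ q : Iwasawa.IwasawaManifold → ℝ, ∀ z, q (Iwasawa.proj z) = p z) ∧
          X.IsLatticeInvariant ∧
          (A ≠ 0 → k ≠ 0 → ¬ X.IsLeftInvariant) ∧
          X.IsHolomorphicTrivialization (fun z =>
            (((1 - p z)⁻¹ : ℝ) : ℂ) • Iwasawa.omega123 p z) ∧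
          X.kodairaDimension = 0)) := by
  constructor
  · intro p hsm hdep hnc hne
    have h : Iwasawa.IsProfile (fun z => p (Iwasawa.proj z)) := ⟨hsm, hdep, fun z => hne _⟩
    have hinv : ∀ γ ∈ Iwasawa.lattice, ∀ z,
        p (Iwasawa.proj (Iwasawa.leftTranslation γ z)) = p (Iwasawa.proj z) := fun γ hγ z => by
      rw [Iwasawa.proj_leftTranslation hγ]
    refine ⟨h.acs, h.isCoframe_iff, Iwasawa.formIsLatticeInvariant_omega hinv,
      h.isLatticeInvariant hinv, fun hL => ?_, h.isIntegrable, h.isHolomorphicTrivialization hinv,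
      h.kodairaDimension_eq_zero hinv⟩
    obtain ⟨a, b, hab⟩ := hnc
    obtain ⟨z, rfl⟩ := Iwasawa.proj_surjective a
    obtain ⟨w, rfl⟩ := Iwasawa.proj_surjective b
    exact hab (h.eq_of_isLeftInvariant hL z w)
  · intro A c s p B hA hs hp hB
    have h : Iwasawa.IsProfile p := Iwasawa.isProfile_sin hA hs hp
    have hsd : Differentiable ℝ s := fun z => (Iwasawa.hasFDerivAt_sin_re hs z).differentiableAt
    have hBp : ∀ z, (B z : ℂ) = (1 - (p z : ℂ) ^ 2)⁻¹ := fun z => by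
      rw [hB, hp]
      push_cast
      ring
    -- Since `p = A s` depends on `x₂` alone, `A ∂_{z₂} s` is half the `x₂`-derivative of `p`.
    have hcoef : ∀ z, (A : ℂ) * B z * Iwasawa.dZ2 s z =
        ((fderiv ℝ p z (Pi.single 1 1) / 2 : ℝ) : ℂ) * (1 - (p z : ℂ) ^ 2)⁻¹ := fun z => by
      have e : fderiv ℝ p z = A • fderiv ℝ s z := by
        rw [show p = fun y => A * s y from funext hp]
        exact fderiv_const_mul (hsd z) A
      rw [hBp, Iwasawa.dZ2_eq hsd (fun z w hzw => by rw [hs, hs, hzw]), e]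
      simp
      ring
    have hdbar : ∀ z v, h.acs.dbar 3 (Iwasawa.omega123 p) z v =
        ((A : ℂ) * B z * Iwasawa.dZ2 s z) *
          Iwasawa.wedge ![Iwasawa.omega p 0 z, Iwasawa.omega p 1 z, Iwasawa.omega p 2 z,
            Iwasawa.conjCovector (Iwasawa.omega p 1 z)] v := fun z v => by
      rw [hcoef, h.dbar_omega123]
    refine ⟨h.acs, h.isCoframe_iff, h.baseChange_psi, h.evalC_omega_psi,
      Iwasawa.extDeriv_omega_zero p, fun z => by rw [hcoef, h.extDeriv_omega_one_eq],
      fun z => by rw [hBp, h.extDeriv_omega_two_eq], h.isIntegrable, hdbar, fun hA0 hc0 => ?_,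
      h.dbar_trivialization, fun k hk => ?_⟩
    -- At the origin `s = 0`, so `B = 1` and `∂_{z₂} s = c / 2`. The vectors `∂_{x₂}` and `∂_{y₂}`
    -- both appear because the form contains `dz₂ ∧ dz̄₂`.
    · refine ⟨0, ![Pi.single 0 1, Pi.single 1 1, Pi.single 1 Complex.I, Pi.single 2 1], ?_⟩
      rw [hdbar]
      refine mul_ne_zero ?_ (Iwasawa.wedge_omega_conj_ne_zero h 0)
      have hs0 : s 0 = 0 := by simp [hs]
      rw [Iwasawa.dZ2_eq hsd (fun z w hzw => by rw [hs, hs, hzw]),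
        (Iwasawa.hasFDerivAt_sin_re hs 0).fderiv, hB, hs0]
      simp [Iwasawa.reCoord, hA0, hc0]
    · have hinv := Iwasawa.sin_profile_leftTranslation hs hp hk
      exact ⟨Iwasawa.exists_descent hinv, h.isLatticeInvariant hinv,
        fun hA0 hk0 hL => Iwasawa.sin_profile_ne hs hp hA0 hk0 hk (h.eq_of_isLeftInvariant hL _ _),
        h.isHolomorphicTrivialization hinv, h.kodairaDimension_eq_zero hinv⟩
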